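/- Fix $1<\alpha<2$ and $P(s)=s^\alpha$. An input is a finite set of jobs; job $i$ arrives at time $a_i$ and consists of finitely many map tasks and exactly $r$ reduce tasks ($r\in\mathbb N$ the same for all jobs), all of arbitrary sizes $\ge 0$. A reduce task is free once all map tasks of its job are completed, and caged before; a map task is always free after its arrival. A schedule on a single server gives to each task, at each time $t$, a nonnegative speed (locally integrable in $t$) that is nonzero only while the task has arrived, is unfinished and is free; preemption is allowed, and several tasks may be processed at once. A task is outstanding if it has arrived and is not completed (a caged task is outstanding, even if its size is $0$; a free task of size $0$ is completed at once). With $n(t)$ the number of outstanding tasks and $s(t)$ the sum of the speeds given to the tasks, the cost of a schedule is the task-based flow time plus energy, $\int \big(n(t)+P(s(t))\big)\,dt\in[0,\infty]$. Let $C^{\mathsf{OPT}}$ be the infimum of the costs of all schedules of the input. Consider the following online algorithm. At time $t$ let $m(t)$ be the number of outstanding map tasks, $J(t)$ the number of jobs that have arrived and have at least one unfinished map task, and $r_f(t)$ the number of outstanding free reduce tasks. The algorithm processes simultaneously those of the following tasks that exist (ties broken arbitrarily): * $M_1$: the outstanding map task of smallest remaining size, at speed $P^{-1}(m(t)+1)$;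 * $M_2$: the map task of smallest remaining size of the job whose remaining cumulative map size (the sum of the remaining sizes of its map tasks) is smallest among the jobs with an unfinished map task, at speed $P^{-1}(r\,J(t)+1)$; * $R_f$: the outstanding free reduce task of smallest remaining size, at speed $P^{-1}(r_f(t)+1)$. If $M_1=M_2$, this task is processed at the sum of the two speeds. Then on every input the algorithm produces a schedule, and every schedule that it produces has cost at most $\big(8+\frac{4}{2-\alpha}+3^{\alpha}\big)\,C^{\mathsf{OPT}}$; that is, the algorithm is $\big(8+\frac{4}{2-\alpha}+3^{\alpha}\big)$-competitive. -/

import Mathlib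

open MeasureTheory
open scoped ENNReal

noncomputable section

namespace MapReduce

/-- A finite sequence of job arrivals. Job `i` arrives at time `arrival i` and consists of map tasks
of sizes `mapSize i k` and reduce tasks of sizes `redSize i l`; tasks of size zero are allowed. -/
structure Input where
  numJobs : ℕ
  arrival : Fin numJobs → ℝ
  numMap : Fin numJobs → ℕ
  numRed : Fin numJobs → ℕ
  mapSize : (i : Fin numJobs) → Fin (numMap i) → ℝ
  redSize : (i : Fin numJobs) → Fin (numRed i) → ℝ
  mapSize_nonneg : ∀ i k, 0 ≤ mapSize i k
  redSize_nonneg : ∀ i l, 0 ≤ redSize i l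

/-- The map tasks of all jobs; `x.1` is the job of `x`. -/
abbrev Input.MapTask (I : Input) : Type := (i : Fin I.numJobs) × Fin (I.numMap i)

/-- The reduce tasks of all jobs; `y.1` is the job of `y`. -/
abbrev Input.RedTask (I : Input) : Type := (i : Fin I.numJobs) × Fin (I.numRed i)

/-- Processing rates on a single server: the speed devoted to each task at each time. -/
structure Rates (I : Input) where
  mapRate : I.MapTask → ℝ → ℝ
  redRate : I.RedTask → ℝ → ℝ

namespace Rates

variable {I : Input} (S : Rates I)

/-- Remaining size of a map task at time `t`. -/
def mapRem (x : I.MapTask) (t : ℝ) : ℝ :=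
  I.mapSize x.1 x.2 - ∫ u in (I.arrival x.1)..t, S.mapRate x u

/-- Remaining size of a reduce task at time `t`. -/
def redRem (y : I.RedTask) (t : ℝ) : ℝ :=
  I.redSize y.1 y.2 - ∫ u in (I.arrival y.1)..t, S.redRate y u

/-- The map task `x` is outstanding: it has arrived and is unfinished. -/
def MapOut (x : I.MapTask) (t : ℝ) : Prop :=
  I.arrival x.1 ≤ t ∧ 0 < S.mapRem x t

/-- Job `i` has arrived and has at least one unfinished map task. -/
def JobMapping (i : Fin I.numJobs) (t : ℝ) : Prop :=
  ∃ k, S.MapOut ⟨i, k⟩ t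

/-- The reduce task `y` is outstanding and free: it has arrived, all map tasks of its job are
completed, and it is unfinished. -/
def RedFree (y : I.RedTask) (t : ℝ) : Prop :=
  I.arrival y.1 ≤ t ∧ ¬ S.JobMapping y.1 t ∧ 0 < S.redRem y t

/-- The reduce task `y` is outstanding and caged: some map task of its job is not completed.
(A caged task of size zero is outstanding until it becomes free.) -/
def RedCaged (y : I.RedTask) (t : ℝ) : Prop :=
  S.JobMapping y.1 t

/-- Remaining cumulative map size of job `i`. -/
def cumMap (i : Fin I.numJobs) (t : ℝ) : ℝ := ∑ k, S.mapRem ⟨i, k⟩ t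

open Classical in
/-- `m(t)`: the number of outstanding map tasks. -/
def numMapOut (t : ℝ) : ℕ := (Finset.univ.filter fun x => S.MapOut x t).card

open Classical in
/-- `J(t)`: the number of jobs with at least one unfinished map task. -/
def numJobMapping (t : ℝ) : ℕ := (Finset.univ.filter fun i => S.JobMapping i t).card

open Classical in
/-- `r_f(t)`: the number of outstanding free reduce tasks. -/
def numRedFree (t : ℝ) : ℕ := (Finset.univ.filter fun y => S.RedFree y t).card

open Classical in
/-- `n_c(t)`: the number of outstanding caged reduce tasks. -/
def numRedCaged (t : ℝ) : ℕ := (Finset.univ.filter fun y => S.RedCaged y t).card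

/-- `n(t) = n_f(t) + n_c(t)`: the number of outstanding tasks, free or caged. -/
def numOut (t : ℝ) : ℕ := S.numMapOut t + S.numRedFree t + S.numRedCaged t

/-- Total speed of the server. -/
def speed (t : ℝ) : ℝ := ∑ x, S.mapRate x t + ∑ y, S.redRate y t

/-- A feasible schedule under the MapReduce constraints: rates are nonnegative and locally
integrable, and a task is processed only after its arrival, while it is unfinished and free. -/
structure Feasible : Prop where
  map_nonneg : ∀ x t, 0 ≤ S.mapRate x t
  red_nonneg : ∀ y t, 0 ≤ S.redRate y t
  map_integrable : ∀ x a b, IntervalIntegrable (S.mapRate x) volume a b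
  red_integrable : ∀ y a b, IntervalIntegrable (S.redRate y) volume a b
  map_available : ∀ x t, S.mapRate x t ≠ 0 → S.MapOut x t
  red_available : ∀ y t, S.redRate y t ≠ 0 → S.RedFree y t

/-- Task-based flow time plus energy, for the power function `P(s) = s ^ α`. -/
def cost (α : ℝ) : ℝ≥0∞ :=
  ∫⁻ t, ((S.numOut t : ℝ≥0∞) + ENNReal.ofReal (S.speed t ^ α))

/-- `x` is a shortest remaining map task among all outstanding map tasks. -/
def IsShortestMap (t : ℝ) (x : I.MapTask) : Prop :=
  S.MapOut x t ∧ ∀ x', S.MapOut x' t → S.mapRem x t ≤ S.mapRem x' t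

/-- `x` is a shortest remaining map task of a job whose remaining cumulative map size is smallest
among all the jobs with an unfinished map task. -/
def IsShortestMapOfSmallestJob (t : ℝ) (x : I.MapTask) : Prop :=
  S.MapOut x t ∧ (∀ i, S.JobMapping i t → S.cumMap x.1 t ≤ S.cumMap i t) ∧
    ∀ k, S.MapOut ⟨x.1, k⟩ t → S.mapRem x t ≤ S.mapRem ⟨x.1, k⟩ t

/-- `y` is a shortest remaining free reduce task among all outstanding free reduce tasks. -/
def IsShortestFreeRed (t : ℝ) (y : I.RedTask) : Prop :=
  S.RedFree y t ∧ ∀ y', S.RedFree y' t → S.redRem y t ≤ S.redRem y' t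

end Rates

/-- `c` is some task with property `p`, or `none` if there is no such task. -/
def Selects {T : Type} (p : T → Prop) (c : Option T) : Prop :=
  (∀ x, c = some x → p x) ∧ (c = none → ∀ x, ¬ p x)

open Classical in
/-- `S` is a schedule produced by the algorithm, with some way of breaking ties, on an input all of
whose jobs have `r` reduce tasks. At each time the selected tasks `M₁`, `M₂`, `R` (those that
exist) get the speeds `P⁻¹(m(t) + 1)`, `P⁻¹(r J(t) + 1)`, `P⁻¹(r_f(t) + 1)`; a task selected both as
`M₁` and as `M₂` gets the sum of the two speeds. -/
structure IsRun {I : Input} (α : ℝ) (r : ℕ) (S : Rates I) : Prop where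
  feasible : S.Feasible
  rule : ∀ t : ℝ, ∃ (M₁ M₂ : Option I.MapTask) (R : Option I.RedTask),
    Selects (S.IsShortestMap t) M₁ ∧
    Selects (S.IsShortestMapOfSmallestJob t) M₂ ∧
    Selects (S.IsShortestFreeRed t) R ∧
    (∀ x, S.mapRate x t =
      (if M₁ = some x then ((S.numMapOut t : ℝ) + 1) ^ (1 / α) else 0) +
      (if M₂ = some x then ((r : ℝ) * (S.numJobMapping t : ℝ) + 1) ^ (1 / α) else 0)) ∧
    (∀ y, S.redRate y t =
      if R = some y then ((S.numRedFree t : ℝ) + 1) ^ (1 / α) else 0)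

/-- The cost of the optimal offline schedule under the MapReduce constraints. -/
def Input.optCost (I : Input) (α : ℝ) : ℝ≥0∞ :=
  ⨅ (S : Rates I) (_ : S.Feasible), S.cost α

end MapReduce

end

/-! The competitive bound is an amortized comparison with an arbitrary feasible schedule. Give each
task a remaining size in both schedules, and let `level` count the tasks whose remaining size is at
least `q`. The potential is the integral over `q` of `F(d)`, where `d` is the excess of the
algorithm's level over the adversary's and `F` has the increasing increments `D(i) = α (c
i)^((α-1)/α)`. Tasks that have not arrived have equal sizes in both schedules and cancel, so
arrivals cost nothing. If the algorithm works on a task with `k` tasks at or above it while the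
adversary has `m`, the potential falls at rate at least `D(k - m)` per unit of work (`pot_work_le`).
Adversary work raises it at rate at most `D(n)`, for `n` the algorithm's number of tasks
(`pot_adversary_le`). The potential starts at zero and stays nonnegative, so the integrated drift is
nonnegative (`zero_le_integral_drift`). Young's inequality bounds the drift pointwise by `V^α +
(α-1) c n - α c (k - m)` (`drift_le`).

Three instances are combined: single map tasks (served by `M₁`), jobs regarded as tasks of size
their cumulative map size and weight `r` (served by `M₂`), and reduce tasks (served by `R_f`). In
the third only free tasks can be processed but caged ones count towards `n`; the surplus `(α-1) r J`
is paid for by the second, which yields `-r J`. The algorithm's energy is bounded by its task counts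
(`IsRun.speed_rpow_le`), and a suitable combination of the three drifts turns flow plus energy into
at most the stated multiple of the adversary's cost rate (`IsRun.cost_le`).

For existence, the selected tasks and their speeds can be kept constant between events. The only
delicate events are those where `M₁` and `M₂` compete for one of the two selection rules. Once a
single task satisfies both rules, processing it preserves this until the next completion or arrival,
so each such period has at most one merger and `rank` strictly decreases from event to event
(`exists_hasStep`, `exists_rates`). -/

namespace MapReduce

/-! ### The excess potential and the effect of work on it -/

section Potential

/-- `F(d) = D(1) + ⋯ + D(d)`, which is `0` for `d ≤ 0`. -/
def potSum (D : ℕ → ℝ) (d : ℤ) : ℝ := ∑ i ∈ Finset.range d.toNat, D (i + 1)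

lemma potSum_nonneg {D : ℕ → ℝ} (hD : ∀ i, 0 ≤ D i) (d : ℤ) : 0 ≤ potSum D d :=
  Finset.sum_nonneg fun _ _ => hD _

lemma potSum_mono {D : ℕ → ℝ} (hD : ∀ i, 0 ≤ D i) : Monotone (potSum D) := by
  intro d e h
  refine Finset.sum_le_sum_of_subset_of_nonneg ?_ fun _ _ _ => hD _
  exact Finset.range_subset_range.2 (Int.toNat_le_toNat h)

lemma potSum_add_one_le {D : ℕ → ℝ} (hD : ∀ i, 0 ≤ D i) (hm : Monotone D) {d : ℤ} {n : ℕ}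
    (h : d + 1 ≤ n) : potSum D (d + 1) ≤ potSum D d + D n := by
  rcases lt_or_ge d 0 with hd | hd
  · have h1 : (d + 1).toNat = 0 := by omega
    have := potSum_nonneg hD d
    have := hD n
    simp only [potSum, h1, Finset.range_zero, Finset.sum_empty] at *
    linarith
  · have h1 : (d + 1).toNat = d.toNat + 1 := by omega
    simp only [potSum, h1, Finset.sum_range_succ]
    have : D (d.toNat + 1) ≤ D n := hm (by omega)
    linarith

lemma potSum_add_le {D : ℕ → ℝ} (hD : ∀ i, 0 ≤ D i) (hm : Monotone D) {d : ℤ} {n : ℕ} (j : ℕ)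
    (h : d + j ≤ n) : potSum D (d + j) ≤ potSum D d + D n * j := by
  induction j with
  | zero => simp
  | succ j ih =>
    have h1 := ih (by push_cast at h; omega)
    have h2 : potSum D (d + j + 1) ≤ potSum D (d + j) + D n :=
      potSum_add_one_le hD hm (by push_cast at h; omega)
    push_cast
    rw [← add_assoc]
    linarith

/-- The top increment of `F` at `d` is at least `D k` because `D` is monotone. If `d ≤ 0` then `k`
truncates to zero, where `D 0 = 0` keeps the bound true. -/
lemma potSum_sub_one_add_le {D : ℕ → ℝ} (hm : Monotone D) (h0 : D 0 = 0) {d k : ℤ} (h : k ≤ d) :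
    potSum D (d - 1) + D k.toNat ≤ potSum D d := by
  rcases lt_or_ge 0 d with hd | hd
  · have h1 : d.toNat = (d - 1).toNat + 1 := by omega
    simp only [potSum, h1, Finset.sum_range_succ]
    have : D k.toNat ≤ D ((d - 1).toNat + 1) := hm (by omega)
    linarith
  · have h1 : d.toNat = 0 := by omega
    have h2 : (d - 1).toNat = 0 := by omega
    have h3 : k.toNat = 0 := by omega
    simp [potSum, h1, h2, h3, h0]

variable {X : Type*} [Fintype X]

/-- The number of tasks whose remaining size is at least `q`. -/
noncomputable def level (a : X → ℝ) (q : ℝ) : ℤ := ∑ x, if q ≤ a x then 1 else 0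

lemma level_nonneg (a : X → ℝ) (q : ℝ) : 0 ≤ level a q :=
  Finset.sum_nonneg fun _ _ => by split_ifs <;> simp

lemma level_le_card (a : X → ℝ) (q : ℝ) : level a q ≤ Fintype.card X := by
  calc level a q ≤ ∑ _x : X, (1 : ℤ) := Finset.sum_le_sum fun _ _ => by split_ifs <;> simp
    _ = _ := by simp

lemma level_mono {a a' : X → ℝ} (h : ∀ x, a' x ≤ a x) (q : ℝ) : level a' q ≤ level a q := by
  refine Finset.sum_le_sum fun x _ => ?_
  have := h x
  split_ifs <;> grind

lemma measurable_level (a : X → ℝ) : Measurable (level a) := by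
  unfold level
  refine Finset.measurable_sum _ fun x _ => ?_
  exact Measurable.ite measurableSet_Iic measurable_const measurable_const

/-- The excess potential of remaining sizes `a` over remaining sizes `o`. -/
noncomputable def pot (D : ℕ → ℝ) (M : ℝ) (a o : X → ℝ) : ℝ :=
  ∫ q in Set.Ioc 0 M, potSum D (level a q - level o q)

lemma integrableOn_potSum_level {D : ℕ → ℝ} (hD : ∀ i, 0 ≤ D i) (M : ℝ) (a o : X → ℝ) :
    IntegrableOn (fun q => potSum D (level a q - level o q)) (Set.Ioc 0 M) := by
  refine IntegrableOn.of_bound (by simp) ?_ (potSum D (Fintype.card X)) ?_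
  · refine Measurable.aestronglyMeasurable ?_
    exact (measurable_of_countable (potSum D)).comp ((measurable_level a).sub (measurable_level o))
  · refine Filter.Eventually.of_forall fun q => ?_
    rw [Real.norm_of_nonneg (potSum_nonneg hD _)]
    refine potSum_mono hD ?_
    have := level_le_card a q
    have := level_nonneg o q
    omega

lemma pot_nonneg {D : ℕ → ℝ} (hD : ∀ i, 0 ≤ D i) (M : ℝ) (a o : X → ℝ) : 0 ≤ pot D M a o :=
  integral_nonneg fun _ => potSum_nonneg hD _

lemma pot_self (D : ℕ → ℝ) (M : ℝ) (a : X → ℝ) : pot D M a a = 0 := by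
  simp [pot, potSum]

lemma pot_mono {D : ℕ → ℝ} (hD : ∀ i, 0 ≤ D i) (M : ℝ) {a a' : X → ℝ} (o : X → ℝ)
    (h : ∀ x, a' x ≤ a x) : pot D M a' o ≤ pot D M a o := by
  refine integral_mono (integrableOn_potSum_level hD M a' o) (integrableOn_potSum_level hD M a o) ?_
  intro q
  refine potSum_mono hD ?_
  have := level_mono h q
  omega

lemma integrableOn_ite_mem_Ioc (M l u : ℝ) :
    IntegrableOn (fun q : ℝ => if l < q ∧ q ≤ u then (1 : ℝ) else 0) (Set.Ioc 0 M) := by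
  refine IntegrableOn.of_bound (by simp) ?_ 1 ?_
  · exact (Measurable.ite measurableSet_Ioc measurable_const measurable_const).aestronglyMeasurable
  · refine Filter.Eventually.of_forall fun q => ?_
    split_ifs <;> simp

lemma integral_ite_mem_Ioc {M l u : ℝ} (hl : 0 ≤ l) (hlu : l ≤ u) (hu : u ≤ M) :
    ∫ q in Set.Ioc 0 M, (if l < q ∧ q ≤ u then (1 : ℝ) else 0) = u - l := by
  have : (fun q : ℝ => if l < q ∧ q ≤ u then (1 : ℝ) else 0) =
      (Set.Ioc l u).indicator fun _ => 1 := by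
    ext q
    simp [Set.indicator, Set.mem_Ioc]
  rw [this, setIntegral_indicator measurableSet_Ioc,
    Set.inter_eq_right.2 (Set.Ioc_subset_Ioc hl hu)]
  simp [hlu]

open Classical in
/-- Work of the algorithm on a task with at least `k` more remaining tasks than the adversary at
its level decreases the potential at rate at least `D k`. -/
lemma pot_work_le {D : ℕ → ℝ} (hD : ∀ i, 0 ≤ D i) (hm : Monotone D) (h0 : D 0 = 0) {M : ℝ}
    {a a' o : X → ℝ} (h : ∀ y, a' y ≤ a y) (B : X → Prop) (hB : ∀ y, ¬ B y → a y = o y) {x : X}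
    (hx0 : 0 ≤ a' x) (hxM : a x ≤ M) {n m : ℕ}
    (hn : n ≤ (Finset.univ.filter fun y => B y ∧ a x ≤ a y).card)
    (hmo : (Finset.univ.filter fun y => B y ∧ 0 < o y).card ≤ m) :
    pot D M a' o ≤ pot D M a o - D (n - m) * (a x - a' x) := by
  rw [← integral_ite_mem_Ioc hx0 (h x) hxM, ← integral_const_mul]
  unfold pot
  rw [← integral_sub (integrableOn_potSum_level hD M a o)
    ((integrableOn_ite_mem_Ioc M _ _).const_mul _)]
  refine setIntegral_mono_on (integrableOn_potSum_level hD M a' o)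
    ((integrableOn_potSum_level hD M a o).sub ((integrableOn_ite_mem_Ioc M _ _).const_mul _))
    measurableSet_Ioc fun q hq => ?_
  have hle := level_mono h q
  split_ifs with hqx
  · have h1 : level a' q + 1 ≤ level a q := by
      have : level a' q + (∑ y, if y = x then (1 : ℤ) else 0) ≤ level a q := by
        unfold level
        rw [← Finset.sum_add_distrib]
        refine Finset.sum_le_sum fun y _ => ?_
        by_cases hy : y = x
        · subst hy
          simp [not_le.2 hqx.1, hqx.2]
        · have := h y
          simp only [hy, if_false, add_zero]
          split_ifs <;> grind
      simpa using this
    -- Outside `B` the two sizes agree and cancel. Inside `B`, every task at or above `a x` is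
    -- counted at level `q ≤ a x`, and the adversary's tasks at level `q > 0` are unfinished.
    have h2 : (n : ℤ) - m ≤ level a q - level o q := by
      have h3 : ((Finset.univ.filter fun y => B y ∧ a x ≤ a y).card : ℤ) -
          (Finset.univ.filter fun y => B y ∧ 0 < o y).card ≤ level a q - level o q := by
        rw [Finset.card_filter, Finset.card_filter]
        push_cast
        unfold level
        rw [← Finset.sum_sub_distrib, ← Finset.sum_sub_distrib]
        refine Finset.sum_le_sum fun y _ => ?_
        by_cases hy : B y
        · have e1 : a x ≤ a y → q ≤ a y := fun h => hqx.2.trans h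
          have e2 : q ≤ o y → 0 < o y := fun h => hq.1.trans_le h
          simp only [hy, true_and]
          split_ifs <;> grind
        · simp [hy, hB y hy]
      have := Int.ofNat_le.2 hn
      have := Int.ofNat_le.2 hmo
      omega
    have h4 := potSum_sub_one_add_le hm h0 h2
    have h5 : ((n : ℤ) - m).toNat = n - m := by omega
    rw [h5] at h4
    have h6 : potSum D (level a' q - level o q) ≤ potSum D (level a q - level o q - 1) :=
      potSum_mono hD (by omega)
    linarith
  · have : potSum D (level a' q - level o q) ≤ potSum D (level a q - level o q) :=
      potSum_mono hD (by omega)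
    linarith

open Classical in
/-- Work of the adversary increases the potential at rate at most `D n`. -/
lemma pot_adversary_le {D : ℕ → ℝ} (hD : ∀ i, 0 ≤ D i) (hm : Monotone D) {M : ℝ}
    {a o o' : X → ℝ} (h : ∀ y, o' y ≤ o y) (B : X → Prop) (hB : ∀ y, ¬ B y → a y = o' y)
    (ho0 : ∀ y, 0 ≤ o' y) (hoM : ∀ y, o y ≤ M) {n : ℕ}
    (hn : (Finset.univ.filter fun y => B y ∧ 0 < a y).card ≤ n) :
    pot D M a o' ≤ pot D M a o + D n * ∑ y, (o y - o' y) := by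
  -- The adversary's work is the integral over `q` of the number of its tasks that fall below `q`,
  -- so the bound can be checked level by level.
  have e : ∑ y, (o y - o' y) =
      ∫ q in Set.Ioc 0 M, ∑ y, (if o' y < q ∧ q ≤ o y then (1 : ℝ) else 0) := by
    rw [integral_finsetSum _ fun y _ => integrableOn_ite_mem_Ioc M _ _]
    exact Finset.sum_congr rfl fun y _ => (integral_ite_mem_Ioc (ho0 y) (h y) (hoM y)).symm
  have hi : IntegrableOn (fun q => ∑ y, (if o' y < q ∧ q ≤ o y then (1 : ℝ) else 0))
      (Set.Ioc 0 M) := integrable_finsetSum _ fun y _ => integrableOn_ite_mem_Ioc M _ _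
  rw [e, ← integral_const_mul]
  unfold pot
  rw [← integral_add (integrableOn_potSum_level hD M a o) (hi.const_mul _)]
  refine setIntegral_mono_on (integrableOn_potSum_level hD M a o')
    ((integrableOn_potSum_level hD M a o).add (hi.const_mul _)) measurableSet_Ioc fun q hq => ?_
  have hle := level_mono h q
  have e1 : (∑ y, (if o' y < q ∧ q ≤ o y then (1 : ℝ) else 0)) =
      (level o q - level o' q).toNat := by
    have : (∑ y, (if o' y < q ∧ q ≤ o y then (1 : ℤ) else 0)) = level o q - level o' q := by
      unfold level
      rw [← Finset.sum_sub_distrib]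
      refine Finset.sum_congr rfl fun y _ => ?_
      have := h y
      split_ifs <;> grind
    have e2 : (((level o q - level o' q).toNat : ℤ) : ℝ) = ((level o q - level o' q : ℤ) : ℝ) := by
      rw [Int.toNat_of_nonneg (by omega)]
    rw [← Int.cast_natCast, e2, ← this]
    push_cast
    rfl
  rw [e1]
  have h2 : level a q - level o' q ≤ n := by
    have : level a q - level o' q ≤ (Finset.univ.filter fun y => B y ∧ 0 < a y).card := by
      rw [Finset.card_filter]
      push_cast
      unfold level
      rw [← Finset.sum_sub_distrib]
      refine Finset.sum_le_sum fun y _ => ?_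
      by_cases hy : B y
      · have e2 : q ≤ a y → 0 < a y := fun h => hq.1.trans_le h
        simp only [hy, true_and]
        split_ifs <;> grind
      · simp [hy, hB y hy]
    have := Int.ofNat_le.2 hn
    omega
  have h3 := potSum_add_le hD hm (d := level a q - level o q) (n := n)
    (level o q - level o' q).toNat (by omega)
  have h4 : level a q - level o q + ((level o q - level o' q).toNat : ℤ) =
    level a q - level o' q := by omega
  rwa [h4] at h3

end Potential

/-! ### From work on the potential to an integrated drift inequality -/

section Drift

open Filter Topology

/-- When both derivatives exist, right-hand slopes determine them. This suits bounds on the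
potential that hold only from `t` until the next arrival. -/
lemma deriv_le_of_eventually_le_right {f g : ℝ → ℝ} {f' g' t : ℝ} (hf : HasDerivAt f f' t)
    (hg : HasDerivAt g g' t) (h : f t = g t) (hle : ∀ᶠ s in 𝓝[>] t, f s ≤ g s) : f' ≤ g' := by
  have hf1 := (hasDerivWithinAt_iff_tendsto_slope' (s := Set.Ioi t) (by simp)).1
    hf.hasDerivWithinAt
  have hg1 := (hasDerivWithinAt_iff_tendsto_slope' (s := Set.Ioi t) (by simp)).1
    hg.hasDerivWithinAt
  refine le_of_tendsto_of_tendsto hf1 hg1 ?_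
  filter_upwards [hle, self_mem_nhdsWithin] with s hs hts
  rw [slope_def_field, slope_def_field, h]
  have : (0 : ℝ) < s - t := sub_pos.2 hts
  gcongr

lemma locallyIntegrable_of_intervalIntegrable {f : ℝ → ℝ}
    (hf : ∀ a b, IntervalIntegrable f volume a b) : LocallyIntegrable f := fun x =>
  ⟨Set.Icc (x - 1) (x + 1), Icc_mem_nhds (by linarith) (by linarith),
    (intervalIntegrable_iff_integrableOn_Icc_of_le (by linarith)).1 (hf _ _)⟩

/-- The remaining size at time `t` of a task of size `s` arriving at time `b` that is processed at
rate `u`. -/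
noncomputable def remSize (s b : ℝ) (u : ℝ → ℝ) (t : ℝ) : ℝ := s - ∫ τ in b..t, u τ

lemma remSize_sub {s b : ℝ} {u : ℝ → ℝ} (hu : ∀ a b, IntervalIntegrable u volume a b) (t t' : ℝ) :
    remSize s b u t - remSize s b u t' = ∫ τ in t..t', u τ := by
  have := intervalIntegral.integral_add_adjacent_intervals (hu b t) (hu t t')
  unfold remSize
  linarith

lemma remSize_antitone {s b : ℝ} {u : ℝ → ℝ} (hu : ∀ a b, IntervalIntegrable u volume a b)
    (h0 : ∀ t, 0 ≤ u t) : Antitone (remSize s b u) := by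
  intro t t' h
  have := remSize_sub (s := s) (b := b) hu t t'
  have := intervalIntegral.integral_nonneg (μ := volume) h fun τ _ => h0 τ
  linarith

lemma continuous_remSize {s b : ℝ} {u : ℝ → ℝ} (hu : ∀ a b, IntervalIntegrable u volume a b) :
    Continuous (remSize s b u) :=
  continuous_const.sub (intervalIntegral.continuous_primitive hu b)

lemma remSize_of_le {s b : ℝ} {u : ℝ → ℝ} (hb : ∀ t, t < b → u t = 0) {t : ℝ} (ht : t ≤ b) :
    remSize s b u t = s := by
  have : ∫ τ in b..t, u τ = 0 := by
    refine intervalIntegral.integral_zero_ae ?_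
    -- The rate may be nonzero at the arrival instant itself, which is a null set.
    have : ∀ᵐ τ : ℝ, τ ≠ b := by simp [ae_iff, measure_singleton]
    filter_upwards [this] with τ h1 h2
    rw [Set.uIoc_of_ge ht] at h2
    exact hb _ (lt_of_le_of_ne h2.2 h1)
  simp [remSize, this]

lemma remSize_le {s b : ℝ} {u : ℝ → ℝ} (hu : ∀ a b, IntervalIntegrable u volume a b)
    (h0 : ∀ t, 0 ≤ u t) (hb : ∀ t, t < b → u t = 0) (t : ℝ) : remSize s b u t ≤ s := by
  rcases le_total t b with h | h
  · exact (remSize_of_le hb h).le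
  · exact (remSize_antitone hu h0 h).trans (remSize_of_le hb le_rfl).le

open Classical in
/-- Drift of the excess potential: an algorithm that devotes speed `sp (k t)` to some task with at
least `k t` tasks at or above its level, against an arbitrary adversary. -/
theorem zero_le_integral_drift {X : Type*} [Fintype X] {σ b : X → ℝ} {u v : X → ℝ → ℝ}
    (hu : ∀ x s t, IntervalIntegrable (u x) volume s t)
    (hv : ∀ x s t, IntervalIntegrable (v x) volume s t)
    (hu0 : ∀ x t, 0 ≤ u x t) (hv0 : ∀ x t, 0 ≤ v x t)
    (hub : ∀ x t, t < b x → u x t = 0) (hvb : ∀ x t, t < b x → v x t = 0)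
    (hA : ∀ x t, 0 ≤ remSize (σ x) (b x) (u x) t) (hO : ∀ x t, 0 ≤ remSize (σ x) (b x) (v x) t)
    {D : ℕ → ℝ} (hD : ∀ i, 0 ≤ D i) (hm : Monotone D) (h0 : D 0 = 0) {sp : ℕ → ℝ}
    {n m k : ℝ → ℕ} (hnm : Measurable n) (hmm : Measurable m) (hkm : Measurable k) {K : ℕ}
    (hnK : ∀ t, n t ≤ K) (hkK : ∀ t, k t ≤ K)
    (hn : ∀ t, (Finset.univ.filter fun y => b y ≤ t ∧ 0 < remSize (σ y) (b y) (u y) t).card ≤ n t)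
    (hmo : ∀ t, (Finset.univ.filter fun y => b y ≤ t ∧
      0 < remSize (σ y) (b y) (v y) t).card ≤ m t)
    (hk : ∀ t, k t = 0 ∨ ∃ x, b x ≤ t ∧ sp (k t) ≤ u x t ∧
      k t ≤ (Finset.univ.filter fun y => b y ≤ t ∧
        remSize (σ x) (b x) (u x) t ≤ remSize (σ y) (b y) (u y) t).card)
    {T₀ T : ℝ} (hT : T₀ ≤ T) (hT₀ : ∀ x, T₀ ≤ b x) :
    IntervalIntegrable (fun t => D (n t) * ∑ x, v x t - D (k t - m t) * sp (k t)) volume T₀ T ∧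
    0 ≤ ∫ t in T₀..T, (D (n t) * ∑ x, v x t - D (k t - m t) * sp (k t)) := by
  set A : X → ℝ → ℝ := fun x => remSize (σ x) (b x) (u x) with hAdef
  set O : X → ℝ → ℝ := fun x => remSize (σ x) (b x) (v x) with hOdef
  have hAa : ∀ x, Antitone (A x) := fun x => remSize_antitone (hu x) (hu0 x)
  have hOa : ∀ x, Antitone (O x) := fun x => remSize_antitone (hv x) (hv0 x)
  have hAs : ∀ x t, A x t ≤ σ x := fun x => remSize_le (hu x) (hu0 x) (hub x)
  have hOs : ∀ x t, O x t ≤ σ x := fun x => remSize_le (hv x) (hv0 x) (hvb x)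
  have hσ : ∀ x, 0 ≤ σ x := fun x => (hA x 0).trans (hAs x 0)
  set M : ℝ := ∑ x, σ x with hM
  have hσM : ∀ x, σ x ≤ M := fun x =>
    Finset.single_le_sum (f := σ) (fun y _ => hσ y) (Finset.mem_univ x)
  set Φ : ℝ → ℝ := fun t => pot D M (fun x => A x t) (fun x => O x t) with hΦ
  set C : ℝ := D (Fintype.card X) with hC
  set W : ℝ → ℝ := fun t => ∑ x, O x t with hW
  -- Adversary work raises `Φ` at rate at most `C`, and `W` falls at exactly the rate of that work,
  -- so adding `C * W` makes the sum antitone. Monotonicity of `H` replaces any absolute continuity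
  -- of `Φ`.
  set H : ℝ → ℝ := fun t => -(Φ t + C * W t) with hH
  set V : ℝ → ℝ := fun t => ∑ x, v x t with hV
  have hVi : ∀ s t, IntervalIntegrable V volume s t := fun s t => by
    have := IntervalIntegrable.sum Finset.univ (f := v) fun x _ => hv x s t
    have e : V = ∑ x, v x := by
      funext t
      simp [hV]
    rwa [e]
  have hmono : Monotone H := by
    intro t t' htt
    have h1 := pot_mono hD M (fun x => O x t) fun x => hAa x htt
    have h2 := pot_adversary_le hD hm (M := M) (a := fun x => A x t') (o := fun x => O x t)
      (o' := fun x => O x t') (fun y => hOa y htt) (fun _ => True) (by simp) (fun y => hO y t')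
      (fun y => (hOs y t).trans (hσM y)) (n := Fintype.card X) (Finset.card_le_univ _)
    simp only [Finset.sum_sub_distrib] at h2
    simp only [hH, hΦ, hW]
    linarith
  have hgi : IntervalIntegrable (fun t => D (n t) * V t - D (k t - m t) * sp (k t)) volume T₀ T := by
    have hDm : Measurable D := measurable_of_countable D
    have hsm : Measurable sp := measurable_of_countable sp
    refine IntervalIntegrable.sub ?_ ?_
    · have := hVi T₀ T
      rw [intervalIntegrable_iff] at this ⊢
      refine Integrable.bdd_mul this (c := D K) (hDm.comp hnm).aestronglyMeasurable ?_
      refine Eventually.of_forall fun t => ?_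
      rw [Real.norm_of_nonneg (hD _)]
      exact hm (hnK t)
    · rw [intervalIntegrable_iff]
      refine IntegrableOn.of_bound (by simp) ?_ (D K * ∑ i ∈ Finset.range (K + 1), |sp i|) ?_
      · have : Measurable fun t => k t - m t := by
          exact (measurable_of_countable (fun p : ℕ × ℕ => p.1 - p.2)).comp (hkm.prodMk hmm)
        exact ((hDm.comp this).mul (hsm.comp hkm)).aestronglyMeasurable
      · refine Eventually.of_forall fun t => ?_
        rw [norm_mul, Real.norm_of_nonneg (hD _), Real.norm_eq_abs]
        have h1 : D (k t - m t) ≤ D K := hm (by have := hkK t; omega)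
        have h2 : |sp (k t)| ≤ ∑ i ∈ Finset.range (K + 1), |sp i| :=
          Finset.single_le_sum (f := fun i => |sp i|) (fun i _ => abs_nonneg _)
            (Finset.mem_range.2 (by have := hkK t; omega))
        exact mul_le_mul h1 h2 (abs_nonneg _) (hD _)
  refine ⟨hgi, ?_⟩
  have hAd : ∀ᵐ t, ∀ x, HasDerivAt (A x) (-u x t) t := by
    rw [ae_all_iff]
    intro x
    filter_upwards [LocallyIntegrable.ae_hasDerivAt_integral
      (locallyIntegrable_of_intervalIntegrable (hu x))]
      with t ht
    exact (ht (b x)).const_sub (σ x)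
  have hOd : ∀ᵐ t, ∀ x, HasDerivAt (O x) (-v x t) t := by
    rw [ae_all_iff]
    intro x
    filter_upwards [LocallyIntegrable.ae_hasDerivAt_integral
      (locallyIntegrable_of_intervalIntegrable (hv x))]
      with t ht
    exact (ht (b x)).const_sub (σ x)
  have hder : ∀ᵐ t, C * V t - (D (n t) * V t - D (k t - m t) * sp (k t)) ≤ deriv H t := by
    filter_upwards [hAd, hOd, hmono.ae_differentiableAt] with t hAt hOt hHt
    have hWt : HasDerivAt W (∑ x, -v x t) t := HasDerivAt.fun_sum fun x _ => hOt x
    have hWV : ∑ x, -v x t = -V t := by simp [hV]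
    rw [hWV] at hWt
    have hlate : ∀ᶠ s in 𝓝[>] t, ∀ y, ¬ b y ≤ t → s < b y := by
      rw [eventually_all]
      intro y
      by_cases hy : b y ≤ t
      · simp [hy]
      · filter_upwards [nhdsWithin_le_nhds (eventually_lt_nhds (not_le.1 hy))] with s hs _ using hs
    -- The move from `t` to `s` is split in two: first the algorithm works against the adversary's
    -- sizes at `t`, then the adversary works against the algorithm's sizes at `s`. This is the
    -- second half.
    have hadv : ∀ᶠ s in 𝓝[>] t, Φ s ≤ pot D M (fun x => A x s) (fun x => O x t) +
        D (n t) * (W t - W s) := by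
      filter_upwards [hlate, self_mem_nhdsWithin] with s hs hts
      have hts : t ≤ s := le_of_lt hts
      have := pot_adversary_le hD hm (M := M) (a := fun x => A x s) (o := fun x => O x t)
        (o' := fun x => O x s) (fun y => hOa y hts) (fun y => b y ≤ t)
        (fun y hy => by
          simp only [hAdef, hOdef]
          rw [remSize_of_le (hub y) (hs y hy).le, remSize_of_le (hvb y) (hs y hy).le])
        (fun y => hO y s) (fun y => (hOs y t).trans (hσM y)) (n := n t)
        ((Finset.card_le_card fun y => by
          simp only [Finset.mem_filter, Finset.mem_univ, true_and]
          exact fun h => ⟨h.1, h.2.trans_le (hAa y hts)⟩).trans (hn t))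
      simpa only [Finset.sum_sub_distrib] using this
    rcases hk t with hk0 | ⟨x, hxt, hsp, hcard⟩
    · have hR : HasDerivAt (fun s => -(Φ t + D (n t) * (W t - W s) + C * W s))
          (-(D (n t) * (- -V t) + C * -V t)) t :=
        (((((hWt.const_sub (W t)).const_mul (D (n t))).const_add (Φ t))).add
          (hWt.const_mul C)).neg
      have := deriv_le_of_eventually_le_right hR hHt.hasDerivAt (by simp [hH]) (by
        filter_upwards [hadv, self_mem_nhdsWithin] with s hs hts
        have h1 := pot_mono hD M (fun x => O x t) fun x => hAa x (le_of_lt hts)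
        simp only [hH]
        have : Φ t = pot D M (fun x => A x t) (fun x => O x t) := rfl
        linarith)
      simp only [hk0, Nat.zero_sub, h0, zero_mul]
      linarith
    · have hR : HasDerivAt (fun s => -(Φ t + D (n t) * (W t - W s) -
          D (k t - m t) * (A x t - A x s) + C * W s))
          (-(D (n t) * (- -V t) - D (k t - m t) * (- -u x t) + C * -V t)) t :=
        ((((((hWt.const_sub (W t)).const_mul (D (n t))).const_add (Φ t))).sub
          (((hAt x).const_sub (A x t)).const_mul _)).add (hWt.const_mul C)).neg
      have := deriv_le_of_eventually_le_right hR hHt.hasDerivAt (by simp [hH]) (by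
        filter_upwards [hadv, self_mem_nhdsWithin] with s hs hts
        have h1 := pot_work_le hD hm h0 (M := M) (a := fun x => A x t) (a' := fun x => A x s)
          (o := fun x => O x t) (fun y => hAa y (le_of_lt hts)) (fun y => b y ≤ t)
          (fun y hy => by
            simp only [hAdef, hOdef]
            rw [remSize_of_le (hub y) (not_le.1 hy).le, remSize_of_le (hvb y) (not_le.1 hy).le])
          (hA x s) ((hAs x t).trans (hσM x)) hcard (hmo t)
        simp only [hH]
        have : Φ t = pot D M (fun x => A x t) (fun x => O x t) := rfl
        linarith)
      have h2 := mul_le_mul_of_nonneg_left hsp (hD (k t - m t))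
      linarith
  -- For a monotone function the integral of the derivative is at most the increment, which is the
  -- direction needed here.
  have hmi := (hmono.monotoneOn (Set.uIcc T₀ T)).intervalIntegral_deriv_mem_uIcc
  have hHi : IntervalIntegrable (deriv H) volume T₀ T :=
    (hmono.monotoneOn (Set.uIcc T₀ T)).intervalIntegrable_deriv
  have hle : ∫ t in T₀..T, deriv H t ≤ H T - H T₀ := by
    rw [Set.uIcc_of_le (sub_nonneg.2 (hmono hT))] at hmi
    exact hmi.2
  have hint : ∫ t in T₀..T, (C * V t - (D (n t) * V t - D (k t - m t) * sp (k t))) ≤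
      ∫ t in T₀..T, deriv H t :=
    intervalIntegral.integral_mono_ae hT (((hVi T₀ T).const_mul C).sub hgi) hHi hder
  rw [intervalIntegral.integral_sub ((hVi T₀ T).const_mul C) hgi,
    intervalIntegral.integral_const_mul] at hint
  have hWV : W T₀ - W T = ∫ t in T₀..T, V t := by
    simp only [hW, hV]
    rw [intervalIntegral.integral_finsetSum fun x _ => hv x T₀ T, ← Finset.sum_sub_distrib]
    exact Finset.sum_congr rfl fun x _ => remSize_sub (hv x) _ _
  have hΦ0 : Φ T₀ = 0 := by
    simp only [hΦ]
    have : (fun x => O x T₀) = fun x => A x T₀ := by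
      ext x
      simp only [hAdef, hOdef]
      rw [remSize_of_le (hub x) (hT₀ x), remSize_of_le (hvb x) (hT₀ x)]
    rw [this, pot_self]
  have hΦT : 0 ≤ Φ T := pot_nonneg hD _ _ _
  rw [← hWV] at hint
  simp only [hH, hΦ0] at hle
  linarith

end Drift

/-! ### Feasible schedules, marginal costs and the three drifts -/

section Competitive

open Filter Topology

/-- A negative value would be preceded by a zero. From that zero on the remaining size is
nonpositive, so the rate vanishes and the size cannot fall further. -/
lemma remSize_nonneg {s b : ℝ} {u : ℝ → ℝ} (hs : 0 ≤ s)
    (hu : ∀ a b, IntervalIntegrable u volume a b) (hb : ∀ t, t < b → u t = 0)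
    (hpos : ∀ t, u t ≠ 0 → 0 < remSize s b u t) (h0 : ∀ t, 0 ≤ u t) (t : ℝ) :
    0 ≤ remSize s b u t := by
  rcases le_total t b with h | h
  · rwa [remSize_of_le hb h]
  · by_contra! hneg
    have hc : ContinuousOn (remSize s b u) (Set.Icc b t) := (continuous_remSize hu).continuousOn
    have h1 : (0 : ℝ) ∈ Set.Icc (remSize s b u t) (remSize s b u b) :=
      ⟨hneg.le, by rwa [remSize_of_le hb le_rfl]⟩
    obtain ⟨z, hz, hz0⟩ := intermediate_value_Icc' h hc h1
    have h2 := remSize_sub (s := s) (b := b) hu z t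
    have h3 : ∫ τ in z..t, u τ = 0 := by
      rw [intervalIntegral.integral_congr (g := fun _ => 0)]
      · simp
      · intro τ hτ
        rw [Set.uIcc_of_le hz.2] at hτ
        by_contra hne
        have h4 := hpos τ hne
        have h5 := remSize_antitone (s := s) (b := b) hu h0 hτ.1
        linarith
    linarith

variable {I : Input} {S : Rates I}

lemma Rates.Feasible.mapRate_eq_zero (hS : S.Feasible) (x : I.MapTask) (t : ℝ)
    (ht : t < I.arrival x.1) : S.mapRate x t = 0 := by
  by_contra h
  exact absurd (hS.map_available x t h).1 (not_le.2 ht)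

lemma Rates.Feasible.redRate_eq_zero (hS : S.Feasible) (y : I.RedTask) (t : ℝ)
    (ht : t < I.arrival y.1) : S.redRate y t = 0 := by
  by_contra h
  exact absurd (hS.red_available y t h).1 (not_le.2 ht)

lemma Rates.Feasible.mapRem_nonneg (hS : S.Feasible) (x : I.MapTask) (t : ℝ) :
    0 ≤ S.mapRem x t :=
  remSize_nonneg (I.mapSize_nonneg _ _) (hS.map_integrable x) (hS.mapRate_eq_zero x)
    (fun t h => (hS.map_available x t h).2) (hS.map_nonneg x) t

lemma Rates.Feasible.redRem_nonneg (hS : S.Feasible) (y : I.RedTask) (t : ℝ) :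
    0 ≤ S.redRem y t :=
  remSize_nonneg (I.redSize_nonneg _ _) (hS.red_integrable y) (hS.redRate_eq_zero y)
    (fun t h => (hS.red_available y t h).2.2) (hS.red_nonneg y) t

/-- The total speed given to the map tasks of job `i`. -/
def Rates.jobRate (S : Rates I) (i : Fin I.numJobs) (t : ℝ) : ℝ := ∑ k, S.mapRate ⟨i, k⟩ t

lemma Rates.Feasible.jobRate_integrable (hS : S.Feasible) (i : Fin I.numJobs) (a b : ℝ) :
    IntervalIntegrable (S.jobRate i) volume a b := by
  have h := IntervalIntegrable.sum (μ := volume) Finset.univ (f := fun k => S.mapRate ⟨i, k⟩)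
    fun k _ => hS.map_integrable ⟨i, k⟩ a b
  have e : S.jobRate i = ∑ k, S.mapRate ⟨i, k⟩ := by
    funext t
    simp [Rates.jobRate]
  rwa [e]

lemma Rates.Feasible.cumMap_eq (hS : S.Feasible) (i : Fin I.numJobs) :
    S.cumMap i = remSize (∑ k, I.mapSize i k) (I.arrival i) (S.jobRate i) := by
  funext t
  simp only [Rates.cumMap, Rates.mapRem, remSize, Rates.jobRate, Finset.sum_sub_distrib]
  rw [intervalIntegral.integral_finsetSum fun k _ => hS.map_integrable ⟨i, k⟩ _ _]

/-- Because remaining sizes are nonnegative, a job behaves like one task of its cumulative map size.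
This is what makes the drift theorem applicable to jobs. -/
lemma Rates.Feasible.jobMapping_iff (hS : S.Feasible) (i : Fin I.numJobs) (t : ℝ) :
    S.JobMapping i t ↔ I.arrival i ≤ t ∧ 0 < S.cumMap i t := by
  constructor
  · rintro ⟨k, hk⟩
    exact ⟨hk.1, Finset.sum_pos' (fun _ _ => hS.mapRem_nonneg _ _) ⟨k, Finset.mem_univ _, hk.2⟩⟩
  · rintro ⟨h1, h2⟩
    obtain ⟨k, -, hk⟩ := Finset.exists_lt_of_sum_lt (s := Finset.univ) (f := fun _ => (0 : ℝ))
      (g := fun k => S.mapRem ⟨i, k⟩ t) (by simpa [Rates.cumMap] using h2)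
    exact ⟨k, h1, hk⟩

lemma Rates.Feasible.cumMap_nonneg (hS : S.Feasible) (i : Fin I.numJobs) (t : ℝ) :
    0 ≤ S.cumMap i t := Finset.sum_nonneg fun _ _ => hS.mapRem_nonneg _ _

lemma Rates.Feasible.measurableSet_mapOut (hS : S.Feasible) (x : I.MapTask) :
    MeasurableSet {t | S.MapOut x t} :=
  measurableSet_Ici.inter (measurableSet_lt measurable_const
    (continuous_remSize (hS.map_integrable x)).measurable)

lemma Rates.Feasible.measurableSet_jobMapping (hS : S.Feasible) (i : Fin I.numJobs) :
    MeasurableSet {t | S.JobMapping i t} := by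
  have : {t | S.JobMapping i t} = ⋃ k, {t | S.MapOut ⟨i, k⟩ t} := by
    ext t
    simp [Rates.JobMapping]
  rw [this]
  exact MeasurableSet.iUnion fun k => hS.measurableSet_mapOut _

lemma Rates.Feasible.measurableSet_redFree (hS : S.Feasible) (y : I.RedTask) :
    MeasurableSet {t | S.RedFree y t} :=
  measurableSet_Ici.inter ((hS.measurableSet_jobMapping y.1).compl.inter
    (measurableSet_lt measurable_const (continuous_remSize (hS.red_integrable y)).measurable))

open Classical in
lemma measurable_card_filter {X : Type*} [Fintype X] {p : X → ℝ → Prop}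
    (hp : ∀ x, MeasurableSet {t | p x t}) :
    Measurable fun t => (Finset.univ.filter fun x => p x t).card := by
  simp only [Finset.card_filter]
  exact Finset.measurable_sum _ fun x _ => Measurable.ite (hp x) measurable_const measurable_const

lemma Rates.Feasible.measurable_numMapOut (hS : S.Feasible) : Measurable S.numMapOut :=
  measurable_card_filter hS.measurableSet_mapOut

lemma Rates.Feasible.measurable_numJobMapping (hS : S.Feasible) : Measurable S.numJobMapping :=
  measurable_card_filter hS.measurableSet_jobMapping

lemma Rates.Feasible.measurable_numRedFree (hS : S.Feasible) : Measurable S.numRedFree :=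
  measurable_card_filter hS.measurableSet_redFree

lemma Rates.numRedCaged_eq {r : ℕ} (hr : ∀ i, I.numRed i = r) (S : Rates I) (t : ℝ) :
    S.numRedCaged t = r * S.numJobMapping t := by
  classical
  unfold Rates.numRedCaged Rates.numJobMapping Rates.RedCaged
  rw [Finset.card_filter, Finset.card_filter, Fintype.sum_sigma, Finset.mul_sum]
  refine Finset.sum_congr rfl fun i _ => ?_
  split_ifs <;> simp [hr]

/-- The marginal potential of the `i`-th task of weight `c`. -/
noncomputable def marginal (α c : ℝ) (i : ℕ) : ℝ := α * (c * i) ^ ((α - 1) / α)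

/-! ### Young's inequality for the marginal potential -/

section Marginal

variable {α c : ℝ}

lemma marginal_nonneg (hα : 1 < α) (hc : 0 ≤ c) (i : ℕ) : 0 ≤ marginal α c i := by
  unfold marginal
  positivity

lemma marginal_mono (hα : 1 < α) (hc : 0 ≤ c) : Monotone (marginal α c) := by
  intro i j h
  have : (0 : ℝ) ≤ (α - 1) / α := div_nonneg (by linarith) (by linarith)
  unfold marginal
  gcongr

lemma marginal_zero (hα : 1 < α) : marginal α c 0 = 0 := by
  have : (α - 1) / α ≠ 0 := div_ne_zero (by linarith) (by linarith)
  simp [marginal, Real.zero_rpow this]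

/-- Young's inequality with the conjugate exponents `α` and `α / (α - 1)`; the exponent in
`marginal` is chosen so that the second term becomes linear in `c * n`. -/
lemma marginal_mul_le (hα : 1 < α) (hc : 0 ≤ c) (n : ℕ) {V : ℝ} (hV : 0 ≤ V) :
    marginal α c n * V ≤ V ^ α + (α - 1) * (c * n) := by
  have h0 : 0 < α := by linarith
  have h1 : 0 < α - 1 := by linarith
  have hcn : 0 ≤ c * n := by positivity
  have hpq : α.HolderConjugate (α / (α - 1)) := Real.HolderConjugate.conjExponent hα
  have := Real.young_inequality_of_nonneg hV (Real.rpow_nonneg hcn ((α - 1) / α)) hpq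
  rw [← Real.rpow_mul hcn, div_mul_div_comm, mul_comm (α - 1) α, div_self (by positivity),
    Real.rpow_one] at this
  have h2 := mul_le_mul_of_nonneg_left this h0.le
  have h3 : α * (V ^ α / α + c * n / (α / (α - 1))) = V ^ α + (α - 1) * (c * n) := by
    field_simp
  rw [h3] at h2
  unfold marginal
  linarith

/-- The exponents `(α - 1) / α` and `1 / α` add up to one, and the speed is at least `(c (k -
m))^(1/α)`. For `k ≤ m` the left side is nonpositive. -/
lemma le_marginal_mul (hα : 1 < α) (hc : 0 ≤ c) (k m : ℕ) :
    α * (c * k - c * m) ≤ marginal α c (k - m) * (c * k + 1) ^ (1 / α) := by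
  have h0 : 0 < α := by linarith
  rcases le_total k m with h | h
  · have h1 : c * k ≤ c * m := by gcongr
    have h2 : 0 ≤ marginal α c (k - m) * (c * k + 1) ^ (1 / α) :=
      mul_nonneg (marginal_nonneg hα hc _) (by positivity)
    nlinarith
  · have hd : ((k - m : ℕ) : ℝ) = k - m := by push_cast [h]; ring
    have hd0 : 0 ≤ c * ((k - m : ℕ) : ℝ) := by positivity
    have h1 : (c * ((k - m : ℕ) : ℝ)) ^ (1 / α) ≤ (c * k + 1) ^ (1 / α) := by
      refine Real.rpow_le_rpow hd0 ?_ (by positivity)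
      rw [hd]
      have : 0 ≤ c * m := by positivity
      linarith
    have h2 : (c * ((k - m : ℕ) : ℝ)) ^ ((α - 1) / α) * (c * ((k - m : ℕ) : ℝ)) ^ (1 / α) =
        c * ((k - m : ℕ) : ℝ) := by
      rw [← Real.rpow_add' hd0 (by field_simp; simpa using h0.ne')]
      have : (α - 1) / α + 1 / α = 1 := by field_simp; ring
      rw [this, Real.rpow_one]
    have h3 : marginal α c (k - m) * (c * ((k - m : ℕ) : ℝ)) ^ (1 / α) =
        α * (c * k - c * m) := by
      unfold marginal
      rw [mul_assoc, h2, hd]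
      ring
    rw [← h3]
    exact mul_le_mul_of_nonneg_left h1 (marginal_nonneg hα hc _)

/-- The drift of the potential with weight `c`: the algorithm has `k` available tasks among which
it selects, and `n` tasks in total, the adversary has `m` tasks and speed `V`. -/
noncomputable def drift (α c : ℝ) (n m k : ℕ) (V : ℝ) : ℝ :=
  marginal α c n * V - marginal α c (k - m) * (c * k + 1) ^ (1 / α)

lemma drift_le (hα : 1 < α) (hc : 0 ≤ c) (n m k : ℕ) {V : ℝ} (hV : 0 ≤ V) :
    drift α c n m k V ≤ V ^ α + (α - 1) * (c * n) - α * (c * k - c * m) := by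
  have h1 := marginal_mul_le hα hc n hV
  have h2 := le_marginal_mul hα hc k m
  unfold drift
  linarith

end Marginal

/-! ### The drifts for map tasks, jobs and reduce tasks -/

variable {α : ℝ} {r : ℕ} {S' : Rates I}

lemma IsRun.exists_mapRate (h : IsRun α r S) (t : ℝ) :
    S.numMapOut t = 0 ∨ ∃ x, S.IsShortestMap t x ∧
      (1 * (S.numMapOut t : ℝ) + 1) ^ (1 / α) ≤ S.mapRate x t := by
  classical
  obtain ⟨M₁, M₂, R, h1, -, -, hm, -⟩ := h.rule t
  rcases M₁ with _ | x
  · left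
    rw [Rates.numMapOut, Finset.card_eq_zero, Finset.filter_eq_empty_iff]
    intro x _ hx
    obtain ⟨z, hz, hz'⟩ := Finset.exists_min_image (Finset.univ.filter fun x => S.MapOut x t)
      (fun x => S.mapRem x t) ⟨x, by simpa using hx⟩
    simp only [Finset.mem_filter, Finset.mem_univ, true_and] at hz hz'
    exact h1.2 rfl z ⟨hz, hz'⟩
  · right
    refine ⟨x, h1.1 x rfl, ?_⟩
    rw [hm x, if_pos rfl, one_mul]
    have : 0 ≤ (if M₂ = some x then ((r : ℝ) * (S.numJobMapping t : ℝ) + 1) ^ (1 / α) else 0) := by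
      split_ifs <;> positivity
    linarith

lemma exists_isShortestMapOfSmallestJob (S : Rates I) (t : ℝ) {i : Fin I.numJobs}
    (hi : S.JobMapping i t) : ∃ x, S.IsShortestMapOfSmallestJob t x := by
  classical
  obtain ⟨j, hj, hj'⟩ := Finset.exists_min_image (Finset.univ.filter fun i => S.JobMapping i t)
    (fun i => S.cumMap i t) ⟨i, by simpa using hi⟩
  simp only [Finset.mem_filter, Finset.mem_univ, true_and] at hj hj'
  obtain ⟨k, hk⟩ := hj
  obtain ⟨z, hz, hz'⟩ := Finset.exists_min_image
    (Finset.univ.filter fun k => S.MapOut ⟨j, k⟩ t) (fun k => S.mapRem ⟨j, k⟩ t)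
    ⟨k, by simpa using hk⟩
  simp only [Finset.mem_filter, Finset.mem_univ, true_and] at hz hz'
  exact ⟨⟨j, z⟩, hz, hj', hz'⟩

lemma IsRun.exists_jobRate (h : IsRun α r S) (t : ℝ) :
    S.numJobMapping t = 0 ∨ ∃ i, S.JobMapping i t ∧
      (∀ j, S.JobMapping j t → S.cumMap i t ≤ S.cumMap j t) ∧
      ((r : ℝ) * (S.numJobMapping t : ℝ) + 1) ^ (1 / α) ≤ S.jobRate i t := by
  classical
  obtain ⟨M₁, M₂, R, -, h2, -, hm, -⟩ := h.rule t
  rcases M₂ with _ | x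
  · left
    rw [Rates.numJobMapping, Finset.card_eq_zero, Finset.filter_eq_empty_iff]
    intro i _ hi
    obtain ⟨x, hx⟩ := exists_isShortestMapOfSmallestJob S t hi
    exact h2.2 rfl x hx
  · right
    obtain ⟨ho, hmin, -⟩ := h2.1 x rfl
    refine ⟨x.1, ⟨x.2, ho⟩, hmin, ?_⟩
    have h3 : S.mapRate x t ≤ S.jobRate x.1 t :=
      Finset.single_le_sum (f := fun k => S.mapRate ⟨x.1, k⟩ t)
        (fun k _ => h.feasible.map_nonneg _ _) (Finset.mem_univ x.2)
    refine le_trans ?_ h3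
    rw [hm x, if_pos rfl]
    have : 0 ≤ (if M₁ = some x then ((S.numMapOut t : ℝ) + 1) ^ (1 / α) else 0) := by
      split_ifs <;> positivity
    linarith

lemma IsRun.exists_redRate (h : IsRun α r S) (t : ℝ) :
    S.numRedFree t = 0 ∨ ∃ y, S.IsShortestFreeRed t y ∧
      (1 * (S.numRedFree t : ℝ) + 1) ^ (1 / α) ≤ S.redRate y t := by
  classical
  obtain ⟨M₁, M₂, R, -, -, h3, -, hm⟩ := h.rule t
  rcases R with _ | x
  · left
    rw [Rates.numRedFree, Finset.card_eq_zero, Finset.filter_eq_empty_iff]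
    intro x _ hx
    obtain ⟨z, hz, hz'⟩ := Finset.exists_min_image (Finset.univ.filter fun x => S.RedFree x t)
      (fun x => S.redRem x t) ⟨x, by simpa using hx⟩
    simp only [Finset.mem_filter, Finset.mem_univ, true_and] at hz hz'
    exact h3.2 rfl z ⟨hz, hz'⟩
  · right
    refine ⟨x, h3.1 x rfl, ?_⟩
    rw [hm x, if_pos rfl, one_mul]

lemma IsRun.map_drift (hα : 1 < α) (h : IsRun α r S) (h' : S'.Feasible) {T₀ T : ℝ} (hT : T₀ ≤ T)
    (hT₀ : ∀ i, T₀ ≤ I.arrival i) :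
    IntervalIntegrable (fun t => drift α 1 (S.numMapOut t) (S'.numMapOut t) (S.numMapOut t)
      (∑ x, S'.mapRate x t)) volume T₀ T ∧
    0 ≤ ∫ t in T₀..T, drift α 1 (S.numMapOut t) (S'.numMapOut t) (S.numMapOut t)
      (∑ x, S'.mapRate x t) := by
  have hS := h.feasible
  refine zero_le_integral_drift (X := I.MapTask) (σ := fun x => I.mapSize x.1 x.2)
    (b := fun x => I.arrival x.1) hS.map_integrable h'.map_integrable hS.map_nonneg h'.map_nonneg
    hS.mapRate_eq_zero h'.mapRate_eq_zero hS.mapRem_nonneg h'.mapRem_nonneg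
    (marginal_nonneg hα zero_le_one) (marginal_mono hα zero_le_one) (marginal_zero hα)
    (sp := fun k => (1 * (k : ℝ) + 1) ^ (1 / α))
    hS.measurable_numMapOut h'.measurable_numMapOut hS.measurable_numMapOut
    (K := Fintype.card I.MapTask) (fun t => Finset.card_le_univ _) (fun t => Finset.card_le_univ _)
    (fun t => Finset.card_le_card fun y => ?_) (fun t => Finset.card_le_card fun y => ?_)
    (fun t => ?_) hT fun x => hT₀ _
  · simp only [Finset.mem_filter, Finset.mem_univ, true_and]
    exact id
  · simp only [Finset.mem_filter, Finset.mem_univ, true_and]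
    exact id
  rcases h.exists_mapRate t with h0 | ⟨x, hx, hsp⟩
  · exact Or.inl h0
  · refine Or.inr ⟨x, hx.1.1, hsp, Finset.card_le_card fun y => ?_⟩
    simp only [Finset.mem_filter, Finset.mem_univ, true_and]
    exact fun hy => ⟨hy.1, hx.2 y hy⟩

/-- Each job is treated as a single task whose rate is the sum of the rates of its map tasks. It
does not matter here which map task inside the smallest job is processed. The weight `r` makes `r J`
the number of caged reduce tasks. -/
lemma IsRun.job_drift (hα : 1 < α) (h : IsRun α r S) (h' : S'.Feasible) {T₀ T : ℝ} (hT : T₀ ≤ T)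
    (hT₀ : ∀ i, T₀ ≤ I.arrival i) :
    IntervalIntegrable (fun t => drift α r (S.numJobMapping t) (S'.numJobMapping t)
      (S.numJobMapping t) (∑ x, S'.mapRate x t)) volume T₀ T ∧
    0 ≤ ∫ t in T₀..T, drift α r (S.numJobMapping t) (S'.numJobMapping t) (S.numJobMapping t)
      (∑ x, S'.mapRate x t) := by
  classical
  have hS := h.feasible
  have e : ∀ t, ∑ x, S'.mapRate x t = ∑ i, S'.jobRate i t := fun t => Fintype.sum_sigma _
  have hr0 : (0 : ℝ) ≤ r := Nat.cast_nonneg r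
  simp only [e]
  refine zero_le_integral_drift (X := Fin I.numJobs) (σ := fun i => ∑ k, I.mapSize i k)
    (b := I.arrival) hS.jobRate_integrable h'.jobRate_integrable
    (fun i t => Finset.sum_nonneg fun k _ => hS.map_nonneg _ _)
    (fun i t => Finset.sum_nonneg fun k _ => h'.map_nonneg _ _)
    (fun i t ht => Finset.sum_eq_zero fun k _ => hS.mapRate_eq_zero ⟨i, k⟩ t ht)
    (fun i t ht => Finset.sum_eq_zero fun k _ => h'.mapRate_eq_zero ⟨i, k⟩ t ht)
    (fun i t => by rw [← hS.cumMap_eq]; exact hS.cumMap_nonneg i t)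
    (fun i t => by rw [← h'.cumMap_eq]; exact h'.cumMap_nonneg i t)
    (marginal_nonneg hα hr0) (marginal_mono hα hr0) (marginal_zero hα)
    (sp := fun k => ((r : ℝ) * (k : ℝ) + 1) ^ (1 / α))
    hS.measurable_numJobMapping h'.measurable_numJobMapping hS.measurable_numJobMapping
    (K := Fintype.card (Fin I.numJobs)) (fun t => Finset.card_le_univ _)
    (fun t => Finset.card_le_univ _)
    (fun t => ?_) (fun t => ?_) (fun t => ?_) hT hT₀
  · refine Finset.card_le_card fun i => ?_
    simp only [Finset.mem_filter, Finset.mem_univ, true_and, ← hS.cumMap_eq, hS.jobMapping_iff]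
    exact id
  · refine Finset.card_le_card fun i => ?_
    simp only [Finset.mem_filter, Finset.mem_univ, true_and, ← h'.cumMap_eq, h'.jobMapping_iff]
    exact id
  · rcases h.exists_jobRate t with h0 | ⟨i, hi, hmin, hsp⟩
    · exact Or.inl h0
    · refine Or.inr ⟨i, ((hS.jobMapping_iff i t).1 hi).1, hsp, Finset.card_le_card fun j => ?_⟩
      simp only [Finset.mem_filter, Finset.mem_univ, true_and, ← hS.cumMap_eq]
      exact fun hj => ⟨((hS.jobMapping_iff j t).1 hj).1, hmin j hj⟩

open Classical in
lemma card_redOut_le (hr : ∀ i, I.numRed i = r) (S : Rates I) (t : ℝ) :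
    (Finset.univ.filter fun y : I.RedTask => I.arrival y.1 ≤ t ∧ 0 < S.redRem y t).card ≤
      S.numRedFree t + r * S.numJobMapping t := by
  rw [← S.numRedCaged_eq hr]
  refine le_trans (Finset.card_le_card ?_) (Finset.card_union_le _ _)
  intro y
  simp only [Finset.mem_filter, Finset.mem_univ, true_and, Finset.mem_union]
  intro hy
  by_cases hj : S.JobMapping y.1 t
  · exact Or.inr hj
  · exact Or.inl ⟨hy.1, hj, hy.2⟩

/-- The potential contains caged tasks, so adversary work is charged against free and caged tasks
together. The algorithm's progress is measured only by the free tasks, because a caged task may be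
shorter than the one being processed. -/
lemma IsRun.red_drift (hα : 1 < α) (hr : ∀ i, I.numRed i = r) (h : IsRun α r S) (h' : S'.Feasible)
    {T₀ T : ℝ} (hT : T₀ ≤ T) (hT₀ : ∀ i, T₀ ≤ I.arrival i) :
    IntervalIntegrable (fun t => drift α 1 (S.numRedFree t + r * S.numJobMapping t)
      (S'.numRedFree t + r * S'.numJobMapping t) (S.numRedFree t)
      (∑ y, S'.redRate y t)) volume T₀ T ∧
    0 ≤ ∫ t in T₀..T, drift α 1 (S.numRedFree t + r * S.numJobMapping t)
      (S'.numRedFree t + r * S'.numJobMapping t) (S.numRedFree t) (∑ y, S'.redRate y t) := by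
  have hS := h.feasible
  have hcard : ∀ t, S.numRedFree t ≤ Fintype.card I.RedTask := fun t => Finset.card_le_univ _
  have hcardJ : ∀ t, S.numJobMapping t ≤ Fintype.card (Fin I.numJobs) :=
    fun t => Finset.card_le_univ _
  refine zero_le_integral_drift (X := I.RedTask) (σ := fun x => I.redSize x.1 x.2)
    (b := fun x => I.arrival x.1) hS.red_integrable h'.red_integrable hS.red_nonneg h'.red_nonneg
    hS.redRate_eq_zero h'.redRate_eq_zero hS.redRem_nonneg h'.redRem_nonneg
    (marginal_nonneg hα zero_le_one) (marginal_mono hα zero_le_one) (marginal_zero hα)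
    (sp := fun k => (1 * (k : ℝ) + 1) ^ (1 / α))
    (hS.measurable_numRedFree.add (hS.measurable_numJobMapping.const_mul r))
    (h'.measurable_numRedFree.add (h'.measurable_numJobMapping.const_mul r))
    hS.measurable_numRedFree
    (K := Fintype.card I.RedTask + r * Fintype.card (Fin I.numJobs))
    (fun t => Nat.add_le_add (hcard t) (Nat.mul_le_mul_left r (hcardJ t)))
    (fun t => (hcard t).trans (Nat.le_add_right _ _))
    (card_redOut_le hr S) (card_redOut_le hr S') (fun t => ?_) hT fun x => hT₀ _
  rcases h.exists_redRate t with h0 | ⟨x, hx, hsp⟩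
  · exact Or.inl h0
  · refine Or.inr ⟨x, hx.1.1, hsp, Finset.card_le_card fun y => ?_⟩
    simp only [Finset.mem_filter, Finset.mem_univ, true_and]
    exact fun hy => ⟨hy.1, hx.2 y hy⟩

end Competitive

/-! ### Energy of the algorithm and the competitive ratio -/

section Ratio

open Filter Topology

/-- Bernoulli's inequality for `(1 + 2)^(α - 1)`, whose exponent lies between 0 and 1. -/
lemma three_rpow_sub_one_le {α : ℝ} (h1 : 1 < α) (h2 : α < 2) :
    (3 : ℝ) ^ (α - 1) ≤ 2 * α - 1 := by
  have := rpow_one_add_le_one_add_mul_self (s := 2) (p := α - 1) (by norm_num) (by linarith)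
    (by linarith)
  norm_num at this
  linarith

lemma rpow_add_three_le {α : ℝ} (h1 : 1 < α) {p q w : ℝ} (hp : 0 ≤ p) (hq : 0 ≤ q) (hw : 0 ≤ w) :
    (p + q + w) ^ α ≤ 3 ^ (α - 1) * (p ^ α + q ^ α + w ^ α) := by
  have := Real.rpow_sum_le_const_mul_sum_rpow_of_nonneg (Finset.univ : Finset (Fin 3))
    (f := ![p, q, w]) h1.le (by
      intro i _
      fin_cases i <;> simpa)
  simpa [Fin.sum_univ_three] using this

/-- The coefficients of the combined drift are at most the competitive ratio. -/
lemma ratio_bounds {α x : ℝ} (h1 : 1 < α) (h2 : α < 2) (hx : x ≤ 2 * α - 1) :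
    α * (1 + 3 * x) ≤ 8 + 4 / (2 - α) + 3 * x ∧
    α * (1 + α + x * (1 + 2 * α)) ≤ 8 + 4 / (2 - α) + 3 * x ∧
    1 + α + x * (2 + 2 * α) ≤ 8 + 4 / (2 - α) + 3 * x := by
  have hy : 0 < 2 - α := by linarith
  have key : ∀ z : ℝ, (z - 8) * (2 - α) ≤ 4 → z ≤ 8 + 4 / (2 - α) := by
    intro z hz
    have := (le_div_iff₀ hy).2 hz
    linarith
  -- The three bounds at the extreme value `x = 2 * α - 1`. After multiplication by `2 - α > 0` they
  -- are polynomial in `α`.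
  have e1 : α * (1 + 3 * (2 * α - 1)) - 3 * (2 * α - 1) ≤ 8 + 4 / (2 - α) := by
    apply key
    nlinarith [sq_nonneg (α - 2), sq_nonneg (α - 1), mul_pos (sub_pos.2 h1) hy]
  have e2 : α * (1 + α + (2 * α - 1) * (1 + 2 * α)) - 3 * (2 * α - 1) ≤ 8 + 4 / (2 - α) := by
    apply key
    have : 0 ≤ (α - 1) * (2 - α) := by nlinarith
    nlinarith [mul_nonneg this (sq_nonneg (α - 1)), mul_nonneg this (sq_nonneg (α - 2)),
      mul_nonneg this (sub_pos.2 h1).le, mul_nonneg this hy.le, sq_nonneg (α - 3 / 2),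
      mul_nonneg this (sq_nonneg (4 * α - 7)), sq_nonneg (α - 2), sq_nonneg (α - 1)]
  have e3 : 1 + α + (2 * α - 1) * (2 + 2 * α) - 3 * (2 * α - 1) ≤ 8 + 4 / (2 - α) := by
    apply key
    have : 0 ≤ (α - 1) * (2 - α) := by nlinarith
    nlinarith [mul_nonneg this (sub_pos.2 h1).le, mul_nonneg this hy.le]
  -- After moving `3 * x` to the left, each bound is affine in `x` with nonnegative slope, so the
  -- extreme value decides.
  refine ⟨?_, ?_, ?_⟩
  · nlinarith
  · nlinarith [mul_nonneg (sub_nonneg.2 hx) (by nlinarith : 0 ≤ α + 2 * α ^ 2 - 3)]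
  · nlinarith

variable {I : Input} {S S' : Rates I} {α : ℝ} {r : ℕ}

lemma Rates.numJobMapping_le (S : Rates I) (t : ℝ) : S.numJobMapping t ≤ S.numMapOut t := by
  classical
  refine le_trans (Finset.card_le_card fun i => ?_) (Finset.card_image_le (f := Sigma.fst))
  simp only [Finset.mem_filter, Finset.mem_univ, true_and, Finset.mem_image]
  rintro ⟨k, hk⟩
  exact ⟨⟨i, k⟩, hk, rfl⟩

lemma Rates.numMapOut_pos {x : I.MapTask} {t : ℝ} (h : S.MapOut x t) : 1 ≤ S.numMapOut t := by
  classical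
  exact Finset.card_pos.2 ⟨x, by simpa using h⟩

lemma Rates.numRedFree_pos {y : I.RedTask} {t : ℝ} (h : S.RedFree y t) : 1 ≤ S.numRedFree t := by
  classical
  exact Finset.card_pos.2 ⟨y, by simpa using h⟩

lemma IsRun.speed_rpow_le (hα : 1 < α) (h : IsRun α r S) (t : ℝ) :
    S.speed t ^ α ≤ 3 ^ (α - 1) *
      (3 * (S.numMapOut t : ℝ) + r * S.numJobMapping t + 2 * S.numRedFree t) := by
  classical
  obtain ⟨M₁, M₂, R, h1, h2, h3, hm, hr⟩ := h.rule t
  have h0 : α ≠ 0 := by linarith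
  have hpow : ∀ z : ℝ, 0 ≤ z → (z ^ (1 / α)) ^ α = z := fun z hz => by
    rw [← Real.rpow_mul hz, one_div, inv_mul_cancel₀ h0, Real.rpow_one]
  have hsum : ∀ (X : Type) [Fintype X] (c : Option X)
      [∀ x, Decidable (c = some x)] (z : ℝ),
      ∑ x, (if c = some x then z else 0) = if c.isSome then z else 0 := by
    intro X _ c _ z
    rcases c with _ | c
    · simp
    · simp
  set p : ℝ := if M₁.isSome then ((S.numMapOut t : ℝ) + 1) ^ (1 / α) else 0 with hp
  set q : ℝ := if M₂.isSome then ((r : ℝ) * (S.numJobMapping t : ℝ) + 1) ^ (1 / α) else 0 with hq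
  set w : ℝ := if R.isSome then ((S.numRedFree t : ℝ) + 1) ^ (1 / α) else 0 with hw
  have hs : S.speed t = p + q + w := by
    unfold Rates.speed
    simp only [hm, hr, Finset.sum_add_distrib, hsum]
    rfl
  have hp' : p ^ α ≤ 2 * S.numMapOut t := by
    rw [hp]
    rcases M₁ with _ | x
    · simp [Real.zero_rpow h0]
    · have : (1 : ℝ) ≤ S.numMapOut t := by exact_mod_cast Rates.numMapOut_pos (h1.1 x rfl).1
      simp only [Option.isSome_some, if_true]
      rw [hpow _ (by positivity)]
      linarith
  -- The extra 1 in the speed of `M₂` is charged to the map tasks, since `r * J` vanishes when `r =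
  -- 0`.
  have hq' : q ^ α ≤ r * S.numJobMapping t + S.numMapOut t := by
    rw [hq]
    rcases M₂ with _ | x
    · simp only [Option.isSome_none, Bool.false_eq_true, if_false, Real.zero_rpow h0]
      positivity
    · have : (1 : ℝ) ≤ S.numMapOut t := by exact_mod_cast Rates.numMapOut_pos (h2.1 x rfl).1
      simp only [Option.isSome_some, if_true]
      rw [hpow _ (by positivity)]
      linarith
  have hw' : w ^ α ≤ 2 * S.numRedFree t := by
    rw [hw]
    rcases R with _ | y
    · simp [Real.zero_rpow h0]
    · have : (1 : ℝ) ≤ S.numRedFree t := by exact_mod_cast Rates.numRedFree_pos (h3.1 y rfl).1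
      simp only [Option.isSome_some, if_true]
      rw [hpow _ (by positivity)]
      linarith
  have hp0 : 0 ≤ p := by rw [hp]; split_ifs <;> positivity
  have hq0 : 0 ≤ q := by rw [hq]; split_ifs <;> positivity
  have hw0 : 0 ≤ w := by rw [hw]; split_ifs <;> positivity
  rw [hs]
  refine (rpow_add_three_le hα hp0 hq0 hw0).trans ?_
  exact mul_le_mul_of_nonneg_left (by linarith) (by positivity)

lemma Rates.numOut_eq (hr : ∀ i, I.numRed i = r) (S : Rates I) (t : ℝ) :
    (S.numOut t : ℝ) = S.numMapOut t + S.numRedFree t + r * S.numJobMapping t := by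
  rw [Rates.numOut, S.numRedCaged_eq hr]
  push_cast
  ring

lemma Rates.Feasible.speed_nonneg (h : S.Feasible) (t : ℝ) : 0 ≤ S.speed t :=
  add_nonneg (Finset.sum_nonneg fun x _ => h.map_nonneg x t)
    (Finset.sum_nonneg fun y _ => h.red_nonneg y t)

lemma lintegral_le_of_forall_Ioc {f : ℝ → ℝ≥0∞} {T₀ : ℝ} {K : ℝ≥0∞} (h0 : ∀ t ≤ T₀, f t = 0)
    (h : ∀ T, T₀ ≤ T → ∫⁻ t in Set.Ioc T₀ T, f t ≤ K) : ∫⁻ t, f t ≤ K := by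
  have e : ∫⁻ t, f t = ∫⁻ t in Set.Ioi T₀, f t := by
    rw [← lintegral_indicator measurableSet_Ioi]
    congr 1
    funext t
    by_cases ht : t ∈ Set.Ioi T₀
    · rw [Set.indicator_of_mem ht]
    · rw [Set.indicator_of_notMem ht, h0 t (not_lt.1 ht)]
  have hu : Set.Ioi T₀ = ⋃ n : ℕ, Set.Ioc T₀ (T₀ + n) := by
    ext t
    simp only [Set.mem_Ioi, Set.mem_iUnion, Set.mem_Ioc]
    constructor
    · intro ht
      obtain ⟨n, hn⟩ := exists_nat_ge (t - T₀)
      exact ⟨n, ht, by linarith⟩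
    · rintro ⟨n, hn, -⟩
      exact hn
  rw [e, hu, setLIntegral_iUnion_of_directed]
  · exact iSup_le fun n => h _ (by simp)
  · refine (monotone_nat_of_le_succ fun n => ?_).directed_le
    refine Set.Ioc_subset_Ioc_right ?_
    push_cast
    linarith

lemma ofReal_integral_le_lintegral {h : ℝ → ℝ} {s : Set ℝ} (hi : IntegrableOn h s) :
    ENNReal.ofReal (∫ t in s, h t) ≤ ∫⁻ t in s, ENNReal.ofReal (h t) := by
  have h1 : ∫ t in s, h t ≤ ∫ t in s, max (h t) 0 :=
    integral_mono hi hi.pos_part fun t => le_max_left _ _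
  refine (ENNReal.ofReal_le_ofReal h1).trans ?_
  rw [ofReal_integral_eq_lintegral_ofReal hi.pos_part
    (Eventually.of_forall fun t => le_max_right _ _)]
  refine lintegral_mono fun t => ?_
  simp [ENNReal.ofReal_max]

lemma intervalIntegrable_natCast {f : ℝ → ℕ} (hf : Measurable f) {K : ℕ} (hK : ∀ t, f t ≤ K)
    (a b : ℝ) : IntervalIntegrable (fun t => (f t : ℝ)) volume a b := by
  rw [intervalIntegrable_iff]
  refine IntegrableOn.of_bound (by simp)
    ((measurable_of_countable (fun n : ℕ => (n : ℝ))).comp hf).aestronglyMeasurable K ?_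
  refine Eventually.of_forall fun t => ?_
  simpa using hK t

theorem IsRun.cost_le (hα1 : 1 < α) (hα2 : α < 2) (hr : ∀ i, I.numRed i = r) (h : IsRun α r S)
    (h' : S'.Feasible) :
    S.cost α ≤ ENNReal.ofReal (8 + 4 / (2 - α) + 3 ^ α) * S'.cost α := by
  have hS := h.feasible
  set x : ℝ := 3 ^ (α - 1) with hx
  have hx1 : 1 ≤ x := Real.one_le_rpow (by norm_num) (by linarith)
  have h3 : (3 : ℝ) ^ α = 3 * x := by
    rw [hx, Real.rpow_sub_one (by norm_num)]
    ring
  rw [h3]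
  set Q : ℝ := 8 + 4 / (2 - α) + 3 * x with hQ
  obtain ⟨k1, k2, k3⟩ := ratio_bounds hα1 hα2 (three_rpow_sub_one_le hα1 hα2)
  rw [← hQ] at k1 k2 k3
  have hQ0 : 0 ≤ Q := le_trans (by positivity) k1
  -- Strictly before all arrivals, so that `f` also vanishes at `T₁` itself.
  obtain ⟨T₁, hT₁⟩ : ∃ T₁, ∀ i, T₁ < I.arrival i := by
    obtain ⟨B, hB⟩ := (Set.finite_range I.arrival).bddBelow
    refine ⟨B - 1, fun i => ?_⟩
    have := hB (Set.mem_range_self i)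
    linarith
  have hT₁' : ∀ i, T₁ ≤ I.arrival i := fun i => (hT₁ i).le
  set f : ℝ → ℝ := fun t => (1 + 3 * x) * S.numMapOut t + (1 + x) * (r * S.numJobMapping t) +
    (1 + 2 * x) * S.numRedFree t with hf
  have hpt : ∀ t, (S.numOut t : ℝ) + S.speed t ^ α ≤ f t := by
    intro t
    have h1 := h.speed_rpow_le hα1 t
    rw [S.numOut_eq hr]
    simp only [hf]
    rw [← hx] at h1
    linarith
  have hf0 : ∀ t, 0 ≤ f t := fun t => by positivity
  have hz : ∀ t ≤ T₁, f t = 0 := by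
    intro t ht
    classical
    have m0 : S.numMapOut t = 0 := by
      rw [Rates.numMapOut, Finset.card_eq_zero, Finset.filter_eq_empty_iff]
      exact fun y _ hy => absurd hy.1 (not_le.2 (ht.trans_lt (hT₁ _)))
    have r0 : S.numRedFree t = 0 := by
      rw [Rates.numRedFree, Finset.card_eq_zero, Finset.filter_eq_empty_iff]
      exact fun y _ hy => absurd hy.1 (not_le.2 (ht.trans_lt (hT₁ _)))
    have j0 : S.numJobMapping t = 0 := by
      have := S.numJobMapping_le t
      omega
    simp [hf, m0, r0, j0]
  have hcost : S.cost α ≤ ∫⁻ t, ENNReal.ofReal (f t) := by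
    refine lintegral_mono fun t => ?_
    rw [← ENNReal.ofReal_natCast, ← ENNReal.ofReal_add (Nat.cast_nonneg _)
      (Real.rpow_nonneg (hS.speed_nonneg t) _)]
    exact ENNReal.ofReal_le_ofReal (hpt t)
  refine hcost.trans (lintegral_le_of_forall_Ioc (T₀ := T₁) (fun t ht => by rw [hz t ht]; simp)
    fun T hT => ?_)
  obtain ⟨i1, d1⟩ := h.map_drift hα1 h' hT hT₁'
  obtain ⟨i2, d2⟩ := h.job_drift hα1 h' hT hT₁'
  obtain ⟨i3, d3⟩ := h.red_drift hα1 hr h' hT hT₁'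
  set g1 := fun t => drift α 1 (S.numMapOut t) (S'.numMapOut t) (S.numMapOut t)
    (∑ x, S'.mapRate x t)
  set g2 := fun t => drift α r (S.numJobMapping t) (S'.numJobMapping t) (S.numJobMapping t)
    (∑ x, S'.mapRate x t)
  set g3 := fun t => drift α 1 (S.numRedFree t + r * S.numJobMapping t)
    (S'.numRedFree t + r * S'.numJobMapping t) (S.numRedFree t) (∑ y, S'.redRate y t)
  -- This weight cancels every `r * J` term of the algorithm: `1 + x` from `f`, and `(1 + 2 * x) *
  -- (α - 1)` from the caged tasks in `g3`. The weights of `g1` and `g3` cancel the map and free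
  -- reduce terms of `f`.
  set c2 : ℝ := 1 + x + (1 + 2 * x) * (α - 1) with hc2
  have hc20 : 0 ≤ c2 := by
    have : 0 ≤ (1 + 2 * x) * (α - 1) := mul_nonneg (by positivity) (by linarith)
    linarith
  have hfi : IntervalIntegrable f volume T₁ T := by
    refine IntervalIntegrable.add (IntervalIntegrable.add ?_ ?_) ?_
    · exact (intervalIntegrable_natCast hS.measurable_numMapOut
        (fun t => Finset.card_le_univ _) _ _).const_mul _
    · exact ((intervalIntegrable_natCast hS.measurable_numJobMapping
        (fun t => Finset.card_le_univ _) _ _).const_mul _).const_mul _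
    · exact (intervalIntegrable_natCast hS.measurable_numRedFree
        (fun t => Finset.card_le_univ _) _ _).const_mul _
  have j1 := i1.const_mul (1 + 3 * x)
  have j2 := i2.const_mul c2
  have j3 := i3.const_mul (1 + 2 * x)
  have hgi := ((hfi.add j1).add j2).add j3
  have hle : ∫ t in T₁..T, f t ≤
      ∫ t in T₁..T, (f t + (1 + 3 * x) * g1 t + c2 * g2 t + (1 + 2 * x) * g3 t) := by
    rw [intervalIntegral.integral_add ((hfi.add j1).add j2) j3,
      intervalIntegral.integral_add (hfi.add j1) j2, intervalIntegral.integral_add hfi j1,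
      intervalIntegral.integral_const_mul, intervalIntegral.integral_const_mul,
      intervalIntegral.integral_const_mul]
    have := mul_nonneg (by positivity : 0 ≤ 1 + 3 * x) d1
    have := mul_nonneg hc20 d2
    have := mul_nonneg (by positivity : 0 ≤ 1 + 2 * x) d3
    linarith
  have hpoint : ∀ t, f t + (1 + 3 * x) * g1 t + c2 * g2 t + (1 + 2 * x) * g3 t ≤
      Q * (S'.numOut t + S'.speed t ^ α) := by
    intro t
    have hVm : 0 ≤ ∑ x, S'.mapRate x t := Finset.sum_nonneg fun x _ => h'.map_nonneg x t
    have hVr : 0 ≤ ∑ y, S'.redRate y t := Finset.sum_nonneg fun y _ => h'.red_nonneg y t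
    have b1 : g1 t ≤ _ := drift_le hα1 zero_le_one _ _ _ hVm
    have b2 : g2 t ≤ _ := drift_le hα1 (Nat.cast_nonneg r) _ _ _ hVm
    have b3 : g3 t ≤ _ := drift_le hα1 zero_le_one _ _ _ hVr
    -- Superadditivity of the power lets the adversary's map and reduce speeds be charged
    -- separately.
    have hsp : (∑ x, S'.mapRate x t) ^ α + (∑ y, S'.redRate y t) ^ α ≤ S'.speed t ^ α :=
      Real.add_rpow_le_rpow_add hVm hVr hα1.le
    have b1' := mul_le_mul_of_nonneg_left b1 (by positivity : 0 ≤ 1 + 3 * x)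
    have b2' := mul_le_mul_of_nonneg_left b2 hc20
    have b3' := mul_le_mul_of_nonneg_left b3 (by positivity : 0 ≤ 1 + 2 * x)
    have hPm : 0 ≤ (∑ x, S'.mapRate x t) ^ α := by positivity
    have hPr : 0 ≤ (∑ y, S'.redRate y t) ^ α := by positivity
    generalize (∑ x, S'.mapRate x t) ^ α = Pm at *
    generalize (∑ y, S'.redRate y t) ^ α = Pr at *
    rw [S'.numOut_eq hr]
    have hRJ : (0 : ℝ) ≤ r * S'.numJobMapping t := by positivity
    have hm0 : (0 : ℝ) ≤ S'.numMapOut t := Nat.cast_nonneg _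
    have hrf0 : (0 : ℝ) ≤ S'.numRedFree t := Nat.cast_nonneg _
    simp only [hf]
    push_cast at b1' b2' b3'
    generalize (r : ℝ) * S'.numJobMapping t = RJ' at *
    generalize (r : ℝ) * S.numJobMapping t = RJ at *
    generalize (S.numMapOut t : ℝ) = m at *
    generalize (S'.numMapOut t : ℝ) = m' at *
    generalize (S.numRedFree t : ℝ) = f at *
    generalize (S'.numRedFree t : ℝ) = f' at *
    have q1 : α * (1 + 3 * x) * m' ≤ Q * m' := mul_le_mul_of_nonneg_right k1 hm0
    have q2 : α * (1 + α + x * (1 + 2 * α)) * RJ' ≤ Q * RJ' := mul_le_mul_of_nonneg_right k2 hRJ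
    have q3 : α * (1 + 2 * x) * f' ≤ Q * f' :=
      mul_le_mul_of_nonneg_right (le_trans (by nlinarith) k1) hrf0
    have q4 : (1 + α + x * (2 + 2 * α) + 0) * Pm ≤ Q * Pm :=
      mul_le_mul_of_nonneg_right (by linarith) hPm
    have q5 : (1 + 2 * x) * Pr ≤ Q * Pr :=
      mul_le_mul_of_nonneg_right (le_trans (by nlinarith) k1) hPr
    have q6 := mul_le_mul_of_nonneg_left hsp hQ0
    rw [hc2] at b2' ⊢
    linarith
  rw [intervalIntegral.integral_of_le hT, intervalIntegral.integral_of_le hT] at hle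
  calc ∫⁻ t in Set.Ioc T₁ T, ENNReal.ofReal (f t)
      = ENNReal.ofReal (∫ t in Set.Ioc T₁ T, f t) :=
        (ofReal_integral_eq_lintegral_ofReal hfi.1 (Eventually.of_forall hf0)).symm
    _ ≤ ENNReal.ofReal (∫ t in Set.Ioc T₁ T,
          (f t + (1 + 3 * x) * g1 t + c2 * g2 t + (1 + 2 * x) * g3 t)) :=
        ENNReal.ofReal_le_ofReal hle
    _ ≤ ∫⁻ t in Set.Ioc T₁ T, ENNReal.ofReal
          (f t + (1 + 3 * x) * g1 t + c2 * g2 t + (1 + 2 * x) * g3 t) :=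
        ofReal_integral_le_lintegral hgi.1
    _ ≤ ∫⁻ t, ENNReal.ofReal
          (f t + (1 + 3 * x) * g1 t + c2 * g2 t + (1 + 2 * x) * g3 t) := setLIntegral_le_lintegral _ _
    _ ≤ ∫⁻ t, ENNReal.ofReal Q * ((S'.numOut t : ℝ≥0∞) + ENNReal.ofReal (S'.speed t ^ α)) := by
        refine lintegral_mono fun t => ?_
        rw [← ENNReal.ofReal_natCast, ← ENNReal.ofReal_add (Nat.cast_nonneg _)
          (Real.rpow_nonneg (h'.speed_nonneg t) _), ← ENNReal.ofReal_mul hQ0]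
        exact ENNReal.ofReal_le_ofReal (hpoint t)
    _ = ENNReal.ofReal Q * S'.cost α := lintegral_const_mul' _ _ ENNReal.ofReal_ne_top

theorem IsRun.cost_le_optCost (hα1 : 1 < α) (hα2 : α < 2) (hr : ∀ i, I.numRed i = r)
    (h : IsRun α r S) :
    S.cost α ≤ ENNReal.ofReal (8 + 4 / (2 - α) + 3 ^ α) * I.optCost α := by
  have h0 : ENNReal.ofReal (8 + 4 / (2 - α) + 3 ^ α) ≠ 0 := by
    have : 0 < 2 - α := by linarith
    rw [ne_eq, ENNReal.ofReal_eq_zero, not_le]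
    positivity
  unfold Input.optCost
  simp_rw [ENNReal.mul_iInf_of_ne h0 ENNReal.ofReal_ne_top]
  exact le_iInf₂ fun S' h' => h.cost_le hα1 hα2 hr h'

end Ratio

/-- A snapshot of the server: which jobs have arrived, and the remaining sizes of all tasks. -/
structure State {J : ℕ} (nm nr : Fin J → ℕ) where
  arrived : Fin J → Prop
  mapRem : ((i : Fin J) × Fin (nm i)) → ℝ
  redRem : ((i : Fin J) × Fin (nr i)) → ℝ

/-! ### Running the algorithm from a snapshot to the next event -/

namespace State

variable {J : ℕ} {nm nr : Fin J → ℕ} (s : State nm nr)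

def MapOut (x : (i : Fin J) × Fin (nm i)) : Prop := s.arrived x.1 ∧ 0 < s.mapRem x

def JobMapping (i : Fin J) : Prop := ∃ k, s.MapOut ⟨i, k⟩

def RedFree (y : (i : Fin J) × Fin (nr i)) : Prop :=
  s.arrived y.1 ∧ ¬ s.JobMapping y.1 ∧ 0 < s.redRem y

noncomputable def cumMap (i : Fin J) : ℝ := ∑ k, s.mapRem ⟨i, k⟩

open Classical in
noncomputable def numMapOut : ℕ := (Finset.univ.filter fun x => s.MapOut x).card

open Classical in
noncomputable def numJobMapping : ℕ := (Finset.univ.filter fun i => s.JobMapping i).card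

open Classical in
noncomputable def numRedFree : ℕ := (Finset.univ.filter fun y => s.RedFree y).card

def IsShortestMap (x : (i : Fin J) × Fin (nm i)) : Prop :=
  s.MapOut x ∧ ∀ x', s.MapOut x' → s.mapRem x ≤ s.mapRem x'

def IsShortestMapOfSmallestJob (x : (i : Fin J) × Fin (nm i)) : Prop :=
  s.MapOut x ∧ (∀ i, s.JobMapping i → s.cumMap x.1 ≤ s.cumMap i) ∧
    ∀ k, s.MapOut ⟨x.1, k⟩ → s.mapRem x ≤ s.mapRem ⟨x.1, k⟩

def IsShortestFreeRed (y : (i : Fin J) × Fin (nr i)) : Prop :=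
  s.RedFree y ∧ ∀ y', s.RedFree y' → s.redRem y ≤ s.redRem y'

open Classical in
/-- The rates that the algorithm gives to the map tasks when it selects `M₁` and `M₂`. -/
noncomputable def mapSpeeds (α : ℝ) (r : ℕ) (M₁ M₂ : Option ((i : Fin J) × Fin (nm i)))
    (x : (i : Fin J) × Fin (nm i)) : ℝ :=
  (if M₁ = some x then ((s.numMapOut : ℝ) + 1) ^ (1 / α) else 0) +
  (if M₂ = some x then ((r : ℝ) * (s.numJobMapping : ℝ) + 1) ^ (1 / α) else 0)

open Classical in
/-- The rates that the algorithm gives to the reduce tasks when it selects `R`. -/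
noncomputable def redSpeeds (α : ℝ) (R : Option ((i : Fin J) × Fin (nr i)))
    (y : (i : Fin J) × Fin (nr i)) : ℝ :=
  if R = some y then ((s.numRedFree : ℝ) + 1) ^ (1 / α) else 0

/-- The rates `um`, `ur` are among those that the algorithm may choose in state `s`. -/
def Rule (α : ℝ) (r : ℕ) (um : ((i : Fin J) × Fin (nm i)) → ℝ)
    (ur : ((i : Fin J) × Fin (nr i)) → ℝ) : Prop :=
  ∃ (M₁ M₂ : Option ((i : Fin J) × Fin (nm i))) (R : Option ((i : Fin J) × Fin (nr i))),
    Selects s.IsShortestMap M₁ ∧ Selects s.IsShortestMapOfSmallestJob M₂ ∧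
    Selects s.IsShortestFreeRed R ∧ (∀ x, um x = s.mapSpeeds α r M₁ M₂ x) ∧
    (∀ y, ur y = s.redSpeeds α R y)

variable {s} {α : ℝ} {r : ℕ}

lemma mapSpeeds_nonneg (M₁ M₂ : Option ((i : Fin J) × Fin (nm i))) (x) :
    0 ≤ s.mapSpeeds α r M₁ M₂ x := by
  unfold mapSpeeds
  split_ifs <;> positivity

lemma redSpeeds_nonneg (R : Option ((i : Fin J) × Fin (nr i))) (y) : 0 ≤ s.redSpeeds α R y := by
  unfold redSpeeds
  split_ifs <;> positivity

lemma mapSpeeds_of_ne {M₁ M₂ : Option ((i : Fin J) × Fin (nm i))} {x} (h1 : M₁ ≠ some x)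
    (h2 : M₂ ≠ some x) : s.mapSpeeds α r M₁ M₂ x = 0 := by
  simp [mapSpeeds, h1, h2]

lemma redSpeeds_of_ne {R : Option ((i : Fin J) × Fin (nr i))} {y} (h : R ≠ some y) :
    s.redSpeeds α R y = 0 := by
  simp [redSpeeds, h]

lemma Rule.map_nonneg {um ur} (h : s.Rule α r um ur) (x) : 0 ≤ um x := by
  obtain ⟨M₁, M₂, R, -, -, -, hm, -⟩ := h
  rw [hm]
  exact mapSpeeds_nonneg _ _ _

lemma Rule.red_nonneg {um ur} (h : s.Rule α r um ur) (y) : 0 ≤ ur y := by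
  obtain ⟨M₁, M₂, R, -, -, -, -, hr⟩ := h
  rw [hr]
  exact redSpeeds_nonneg _ _

lemma Rule.mapOut {um ur} (h : s.Rule α r um ur) {x} (hx : um x ≠ 0) : s.MapOut x := by
  obtain ⟨M₁, M₂, R, h1, h2, -, hm, -⟩ := h
  rw [hm] at hx
  by_cases e1 : M₁ = some x
  · exact (h1.1 x e1).1
  by_cases e2 : M₂ = some x
  · exact (h2.1 x e2).1
  exact absurd (mapSpeeds_of_ne e1 e2) hx

lemma Rule.redFree {um ur} (h : s.Rule α r um ur) {y} (hy : ur y ≠ 0) : s.RedFree y := by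
  obtain ⟨M₁, M₂, R, -, -, h3, -, hr⟩ := h
  rw [hr] at hy
  by_cases e1 : R = some y
  · exact (h3.1 y e1).1
  exact absurd (redSpeeds_of_ne e1) hy

lemma rule_of_not_arrived (h : ∀ i, ¬ s.arrived i) : s.Rule α r (fun _ => 0) (fun _ => 0) :=
  ⟨none, none, none, ⟨by simp, fun _ x hx => h _ hx.1.1⟩, ⟨by simp, fun _ x hx => h _ hx.1.1⟩,
    ⟨by simp, fun _ x hx => h _ hx.1.1⟩, fun _ => by simp [mapSpeeds], fun _ => by simp [redSpeeds]⟩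

lemma exists_isShortestMap {x} (hx : s.MapOut x) : ∃ x, s.IsShortestMap x := by
  obtain ⟨z, hz, hz'⟩ := Set.exists_min_image {x | s.MapOut x} s.mapRem (Set.toFinite _) ⟨x, hx⟩
  exact ⟨z, hz, hz'⟩

lemma exists_isShortestFreeRed {y} (hy : s.RedFree y) : ∃ y, s.IsShortestFreeRed y := by
  obtain ⟨z, hz, hz'⟩ := Set.exists_min_image {x | s.RedFree x} s.redRem (Set.toFinite _) ⟨y, hy⟩
  exact ⟨z, hz, hz'⟩

lemma exists_isShortestMapOfSmallestJob {x} (hx : s.MapOut x) :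
    ∃ x, s.IsShortestMapOfSmallestJob x := by
  obtain ⟨j, ⟨k, hk⟩, hj⟩ := Set.exists_min_image {i | s.JobMapping i} s.cumMap (Set.toFinite _)
    ⟨x.1, x.2, hx⟩
  obtain ⟨z, hz, hz'⟩ := Set.exists_min_image {k | s.MapOut ⟨j, k⟩} (fun k => s.mapRem ⟨j, k⟩)
    (Set.toFinite _) ⟨k, hk⟩
  exact ⟨⟨j, z⟩, hz, hj, hz'⟩

lemma exists_selects {T : Type} (p : T → Prop) : ∃ c, Selects p c := by
  by_cases h : ∃ x, p x
  · obtain ⟨x, hx⟩ := h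
    exact ⟨some x, by simpa [Selects] using hx⟩
  · exact ⟨none, by simpa [Selects] using h⟩

/-- The state after time `τ` of processing at constant rates. -/
def advance (s : State nm nr) (um : ((i : Fin J) × Fin (nm i)) → ℝ)
    (ur : ((i : Fin J) × Fin (nr i)) → ℝ) (τ : ℝ) : State nm nr where
  arrived := s.arrived
  mapRem x := s.mapRem x - um x * τ
  redRem y := s.redRem y - ur y * τ

section Advance

variable {um : ((i : Fin J) × Fin (nm i)) → ℝ} {ur : ((i : Fin J) × Fin (nr i)) → ℝ} {τ : ℝ}

lemma mapOut_advance (hum : ∀ x, 0 ≤ um x) (hτ : 0 ≤ τ)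
    (hpos : ∀ x, s.MapOut x → 0 < s.mapRem x - um x * τ) :
    (s.advance um ur τ).MapOut = s.MapOut := by
  funext x
  refine propext ⟨fun h => ⟨h.1, ?_⟩, fun h => ⟨h.1, hpos x h⟩⟩
  have h2 : 0 < s.mapRem x - um x * τ := h.2
  have := mul_nonneg (hum x) hτ
  linarith

lemma jobMapping_advance (h : (s.advance um ur τ).MapOut = s.MapOut) :
    (s.advance um ur τ).JobMapping = s.JobMapping := by
  unfold JobMapping
  rw [h]

lemma redFree_advance (h : (s.advance um ur τ).MapOut = s.MapOut) (hur : ∀ y, 0 ≤ ur y)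
    (hτ : 0 ≤ τ) (hpos : ∀ y, s.RedFree y → 0 < s.redRem y - ur y * τ) :
    (s.advance um ur τ).RedFree = s.RedFree := by
  have hj := jobMapping_advance h
  funext y
  refine propext ⟨fun h => ⟨h.1, hj ▸ h.2.1, ?_⟩, fun h => ⟨h.1, hj ▸ h.2.1, hpos y h⟩⟩
  have h2 : 0 < s.redRem y - ur y * τ := h.2.2
  have := mul_nonneg (hur y) hτ
  linarith

/-- The selection rules of `M₁` and `M₂` still hold after time `τ`. -/
def Persists (s : State nm nr) (um : ((i : Fin J) × Fin (nm i)) → ℝ)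
    (M₁ M₂ : Option ((i : Fin J) × Fin (nm i))) (τ : ℝ) : Prop :=
  (∀ x, M₁ = some x → ∀ x', s.MapOut x' → s.mapRem x - um x * τ ≤ s.mapRem x' - um x' * τ) ∧
  ∀ x, M₂ = some x →
    (∀ i, s.JobMapping i → ∑ k, (s.mapRem ⟨x.1, k⟩ - um ⟨x.1, k⟩ * τ) ≤
      ∑ k, (s.mapRem ⟨i, k⟩ - um ⟨i, k⟩ * τ)) ∧
    ∀ k, s.MapOut ⟨x.1, k⟩ → s.mapRem x - um x * τ ≤ s.mapRem ⟨x.1, k⟩ - um ⟨x.1, k⟩ * τ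

/-- As long as no selected task finishes, the outstanding sets, and hence the speeds, stay the same.
The choice of `R` persists by itself, since only the shortest free task shrinks. `M₁` and `M₂` can
overtake each other, hence the hypothesis `Persists`. -/
lemma rule_advance {M₁ M₂ R} (h1 : Selects s.IsShortestMap M₁)
    (h2 : Selects s.IsShortestMapOfSmallestJob M₂) (h3 : Selects s.IsShortestFreeRed R)
    (hτ : 0 ≤ τ) (hm : ∀ x, s.MapOut x → 0 < s.mapRem x - s.mapSpeeds α r M₁ M₂ x * τ)
    (hr : ∀ y, s.RedFree y → 0 < s.redRem y - s.redSpeeds α R y * τ)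
    (hp : s.Persists (s.mapSpeeds α r M₁ M₂) M₁ M₂ τ) :
    (s.advance (s.mapSpeeds α r M₁ M₂) (s.redSpeeds α R) τ).Rule α r (s.mapSpeeds α r M₁ M₂)
      (s.redSpeeds α R) := by
  have e1 := mapOut_advance (um := s.mapSpeeds α r M₁ M₂) (ur := s.redSpeeds α R) (fun x => mapSpeeds_nonneg _ _ x) hτ hm
  have e2 := jobMapping_advance e1
  have e3 := redFree_advance e1 (fun y => redSpeeds_nonneg _ y) hτ hr
  refine ⟨M₁, M₂, R, ⟨?_, ?_⟩, ⟨?_, ?_⟩, ⟨?_, ?_⟩, ?_, ?_⟩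
  · intro x hx
    refine ⟨by rw [e1]; exact (h1.1 x hx).1, ?_⟩
    rw [e1]
    exact hp.1 x hx
  · intro hn x hx
    have : s.MapOut x := by rw [← e1]; exact hx.1
    obtain ⟨z, hz⟩ := exists_isShortestMap this
    exact h1.2 hn z hz
  · intro x hx
    refine ⟨by rw [e1]; exact (h2.1 x hx).1, ?_⟩
    rw [e1, e2]
    exact hp.2 x hx
  · intro hn x hx
    have : s.MapOut x := by rw [← e1]; exact hx.1
    obtain ⟨z, hz⟩ := exists_isShortestMapOfSmallestJob this
    exact h2.2 hn z hz
  · intro y hy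
    refine ⟨by rw [e3]; exact (h3.1 y hy).1, ?_⟩
    rw [e3]
    intro y' hy'
    by_cases hyy : y' = y
    · rw [hyy]
    · have h4 : s.redSpeeds α R y' = 0 := redSpeeds_of_ne (by
        rw [hy]
        exact fun h => hyy (Option.some.inj h).symm)
      have h5 := (h3.1 y hy).2 y' hy'
      have h6 := mul_nonneg (redSpeeds_nonneg (s := s) (α := α) R y) hτ
      change s.redRem y - s.redSpeeds α R y * τ ≤ s.redRem y' - s.redSpeeds α R y' * τ
      rw [h4]
      linarith
  · intro hn y hy
    have : s.RedFree y := by rw [← e3]; exact hy.1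
    obtain ⟨z, hz⟩ := exists_isShortestFreeRed this
    exact h3.2 hn z hz
  · intro x
    have n1 : (s.advance (s.mapSpeeds α r M₁ M₂) (s.redSpeeds α R) τ).numMapOut = s.numMapOut := by
      unfold numMapOut
      rw [e1]
    have n2 : (s.advance (s.mapSpeeds α r M₁ M₂) (s.redSpeeds α R) τ).numJobMapping =
        s.numJobMapping := by
      unfold numJobMapping
      rw [e2]
    simp only [mapSpeeds, n1, n2]
  · intro y
    have n3 : (s.advance (s.mapSpeeds α r M₁ M₂) (s.redSpeeds α R) τ).numRedFree =
        s.numRedFree := by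
      unfold numRedFree
      rw [e3]
    simp only [redSpeeds, n3]

end Advance

/-- Some map task qualifies both as `M₁` and as `M₂`, or no map task is outstanding. -/
def Coherent (s : State nm nr) : Prop :=
  (∃ x, s.IsShortestMap x ∧ s.IsShortestMapOfSmallestJob x) ∨ ∀ x, ¬ s.MapOut x

open Classical in
/-- The number of completions and arrivals to come. -/
noncomputable def pending (s : State nm nr) : ℕ :=
  (Finset.univ.filter fun x => 0 < s.mapRem x).card +
  (Finset.univ.filter fun y => 0 < s.redRem y).card +
  (Finset.univ.filter fun i => ¬ s.arrived i).card

open Classical in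
/-- A bound on the number of events to come, including mergers of `M₁` and `M₂`. -/
noncomputable def rank (s : State nm nr) : ℕ := 2 * s.pending + if s.Coherent then 0 else 1

/-- A pair `p` encodes the linear function `p.1 - p.2 * τ`. The first zero is the smallest quotient
`p.1 / p.2` among the decreasing functions. -/
lemma exists_first_zero {E : Set (ℝ × ℝ)} (hE : E.Finite) (hpos : ∀ p ∈ E, 0 < p.1) :
    (∀ τ, 0 ≤ τ → ∀ p ∈ E, 0 < p.1 - p.2 * τ) ∨
    ∃ τ₁, 0 < τ₁ ∧ (∀ τ, 0 ≤ τ → τ < τ₁ → ∀ p ∈ E, 0 < p.1 - p.2 * τ) ∧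
      (∀ p ∈ E, 0 ≤ p.1 - p.2 * τ₁) ∧ ∃ p ∈ E, p.1 - p.2 * τ₁ = 0 := by
  by_cases hne : {p ∈ E | 0 < p.2}.Nonempty
  · right
    obtain ⟨p, ⟨hp, hp2⟩, hmin⟩ := Set.exists_min_image {p ∈ E | 0 < p.2} (fun p => p.1 / p.2)
      (hE.subset (Set.sep_subset _ _)) hne
    have hτ : 0 < p.1 / p.2 := div_pos (hpos p hp) hp2
    refine ⟨p.1 / p.2, hτ, fun τ h0 hlt q hq => ?_, fun q hq => ?_, p, hp, ?_⟩
    · rcases lt_or_ge 0 q.2 with h | h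
      · have := hlt.trans_le (hmin q ⟨hq, h⟩)
        rw [lt_div_iff₀ h] at this
        linarith
      · have := hpos q hq
        nlinarith
    · rcases lt_or_ge 0 q.2 with h | h
      · have := hmin q ⟨hq, h⟩
        rw [le_div_iff₀ h] at this
        linarith
      · have := hpos q hq
        nlinarith
    · field_simp
      ring
  · left
    intro τ hτ p hp
    have h1 : ¬ 0 < p.2 := fun h => hne ⟨p, hp, h⟩
    have := hpos p hp
    nlinarith

/-- The arrivals in the next `τ` time units, with `gap i` the time until the arrival of job `i`. -/
def arrive (s : State nm nr) (gap : Fin J → ℝ) (τ : ℝ) : State nm nr where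
  arrived i := s.arrived i ∨ gap i ≤ τ
  mapRem := s.mapRem
  redRem := s.redRem

/-- The algorithm can process at the rates `um`, `ur` from state `s` on, forever or up to an event
that lowers the rank. -/
def HasStep (s : State nm nr) (α : ℝ) (r : ℕ) (gap : Fin J → ℝ)
    (um : ((i : Fin J) × Fin (nm i)) → ℝ) (ur : ((i : Fin J) × Fin (nr i)) → ℝ) : Prop :=
  ((∀ τ, 0 ≤ τ → (s.advance um ur τ).Rule α r um ur) ∧ ∀ i, s.arrived i) ∨
  ∃ τ₁, 0 < τ₁ ∧ (∀ τ, 0 ≤ τ → τ < τ₁ → (s.advance um ur τ).Rule α r um ur) ∧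
    (∀ x, 0 ≤ s.mapRem x - um x * τ₁) ∧ (∀ y, 0 ≤ s.redRem y - ur y * τ₁) ∧
    (∀ i, ¬ s.arrived i → τ₁ ≤ gap i) ∧ ((s.advance um ur τ₁).arrive gap τ₁).rank < s.rank

lemma rule_self {M₁ M₂ R} (h1 : Selects s.IsShortestMap M₁)
    (h2 : Selects s.IsShortestMapOfSmallestJob M₂) (h3 : Selects s.IsShortestFreeRed R) :
    s.Rule α r (s.mapSpeeds α r M₁ M₂) (s.redSpeeds α R) :=
  ⟨M₁, M₂, R, h1, h2, h3, fun _ => rfl, fun _ => rfl⟩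

/-- `E` is a set of linear functions whose positivity makes the selection persist, and whose first
zero is a merger of `M₁` and `M₂`. -/
lemma hasStep_of_selects (hm0 : ∀ x, 0 ≤ s.mapRem x) (hr0 : ∀ y, 0 ≤ s.redRem y) {gap : Fin J → ℝ}
    (hgap : ∀ i, ¬ s.arrived i → 0 < gap i) {M₁ M₂ R} (h1 : Selects s.IsShortestMap M₁)
    (h2 : Selects s.IsShortestMapOfSmallestJob M₂) (h3 : Selects s.IsShortestFreeRed R)
    {E : Set (ℝ × ℝ)} (hE : E.Finite) (hEpos : ∀ p ∈ E, 0 < p.1)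
    (hper : ∀ τ, 0 ≤ τ → (∀ p ∈ E, 0 ≤ p.1 - p.2 * τ) →
      s.Persists (s.mapSpeeds α r M₁ M₂) M₁ M₂ τ)
    (hmerge : ∀ τ, 0 ≤ τ → (∀ x, s.MapOut x → 0 < s.mapRem x - s.mapSpeeds α r M₁ M₂ x * τ) →
      (∀ p ∈ E, 0 ≤ p.1 - p.2 * τ) → (∃ p ∈ E, p.1 - p.2 * τ = 0) →
      (s.advance (s.mapSpeeds α r M₁ M₂) (s.redSpeeds α R) τ).Coherent ∧ ¬ s.Coherent) :
    s.HasStep α r gap (s.mapSpeeds α r M₁ M₂) (s.redSpeeds α R) := by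
  classical
  set um := s.mapSpeeds α r M₁ M₂ with hum
  set ur := s.redSpeeds α R with hur
  have hrule : s.Rule α r um ur := rule_self h1 h2 h3
  -- All event clocks together: mergers, map completions, completions of free reduce tasks, and
  -- arrivals.
  set E' : Set (ℝ × ℝ) := E ∪ (Set.range (fun x : {x // s.MapOut x} => (s.mapRem x, um x)) ∪
    (Set.range (fun y : {y // s.RedFree y} => (s.redRem y, ur y)) ∪
    Set.range (fun i : {i // ¬ s.arrived i} => (gap i, (1 : ℝ))))) with hE'
  have hE'f : E'.Finite := hE.union ((Set.finite_range _).union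
    ((Set.finite_range _).union (Set.finite_range _)))
  have mE : ∀ p ∈ E, p ∈ E' := fun p hp => Or.inl hp
  have mM : ∀ x, s.MapOut x → (s.mapRem x, um x) ∈ E' :=
    fun x hx => Or.inr (Or.inl ⟨⟨x, hx⟩, rfl⟩)
  have mR : ∀ y, s.RedFree y → (s.redRem y, ur y) ∈ E' :=
    fun y hy => Or.inr (Or.inr (Or.inl ⟨⟨y, hy⟩, rfl⟩))
  have mG : ∀ i, ¬ s.arrived i → (gap i, (1 : ℝ)) ∈ E' :=
    fun i hi => Or.inr (Or.inr (Or.inr ⟨⟨i, hi⟩, rfl⟩))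
  have hE'pos : ∀ p ∈ E', 0 < p.1 := by
    rintro p (hp | ⟨x, rfl⟩ | ⟨y, rfl⟩ | ⟨i, rfl⟩)
    · exact hEpos p hp
    · exact x.2.2
    · exact y.2.2.2
    · exact hgap i i.2
  have hadv : ∀ τ, 0 ≤ τ → (∀ p ∈ E', 0 < p.1 - p.2 * τ) → (s.advance um ur τ).Rule α r um ur :=
    fun τ hτ hp => rule_advance h1 h2 h3 hτ (fun x hx => hp _ (mM x hx))
      (fun y hy => hp _ (mR y hy)) (hper τ hτ fun p h => (hp p (mE p h)).le)
  rcases exists_first_zero hE'f hE'pos with hall | ⟨τ₁, hτ₁, hlt, hnn, p, hp, hp0⟩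
  · refine Or.inl ⟨fun τ hτ => hadv τ hτ (hall τ hτ), fun i => ?_⟩
    by_contra hi
    have := hall (gap i) (hgap i hi).le _ (mG i hi)
    simp at this
  · refine Or.inr ⟨τ₁, hτ₁, fun τ h0 h => hadv τ h0 (hlt τ h0 h), fun x => ?_, fun y => ?_,
      fun i hi => by have := hnn _ (mG i hi); simpa using this, ?_⟩
    · by_cases hx : um x = 0
      · rw [hx]
        simpa using hm0 x
      · exact hnn _ (mM x (hrule.mapOut hx))
    · by_cases hy : ur y = 0
      · rw [hy]
        simpa using hr0 y
      · exact hnn _ (mR y (hrule.redFree hy))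
    set s' := (s.advance um ur τ₁).arrive gap τ₁ with hs'
    have hm' : ∀ x, s'.mapRem x = s.mapRem x - um x * τ₁ := fun _ => rfl
    have hr' : ∀ x, s'.redRem x = s.redRem x - ur x * τ₁ := fun _ => rfl
    have hmle : ∀ x, s'.mapRem x ≤ s.mapRem x := fun x => by
      have := mul_nonneg (hrule.map_nonneg x) hτ₁.le
      rw [hm']
      linarith
    have hrle : ∀ x, s'.redRem x ≤ s.redRem x := fun x => by
      have := mul_nonneg (hrule.red_nonneg x) hτ₁.le
      rw [hr']
      linarith
    have sM : (Finset.univ.filter fun x => 0 < s'.mapRem x) ⊆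
        Finset.univ.filter fun x => 0 < s.mapRem x := fun x => by
      simpa using fun h => h.trans_le (hmle x)
    have sR : (Finset.univ.filter fun x => 0 < s'.redRem x) ⊆
        Finset.univ.filter fun x => 0 < s.redRem x := fun x => by
      simpa using fun h => h.trans_le (hrle x)
    have sG : (Finset.univ.filter fun i => ¬ s'.arrived i) ⊆
        Finset.univ.filter fun i => ¬ s.arrived i := fun i => by
      simpa using fun h h' => h (Or.inl h')
    have cM := Finset.card_le_card sM
    have cR := Finset.card_le_card sR
    have cG := Finset.card_le_card sG
    -- A completion or arrival may destroy coherence, which costs 1; the factor 2 in `rank` pays for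
    -- it.
    have key : s'.pending < s.pending → s'.rank < s.rank := by
      intro h
      unfold rank
      split_ifs <;> omega
    have kM : ∀ x, s.MapOut x → s.mapRem x - um x * τ₁ = 0 → s'.pending < s.pending := by
      intro x hx h0
      have : (Finset.univ.filter fun x => 0 < s'.mapRem x).card <
          (Finset.univ.filter fun x => 0 < s.mapRem x).card := by
        refine Finset.card_lt_card ((Finset.ssubset_iff_of_subset sM).2 ⟨x, ?_, ?_⟩)
        · simpa using hx.2
        · simp only [Finset.mem_filter, not_and, not_lt]
          intro _
          rw [hm', h0]
      unfold pending
      omega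
    have kR : ∀ x, s.RedFree x → s.redRem x - ur x * τ₁ = 0 → s'.pending < s.pending := by
      intro x hx h0
      have : (Finset.univ.filter fun x => 0 < s'.redRem x).card <
          (Finset.univ.filter fun x => 0 < s.redRem x).card := by
        refine Finset.card_lt_card ((Finset.ssubset_iff_of_subset sR).2 ⟨x, ?_, ?_⟩)
        · simpa using hx.2.2
        · simp only [Finset.mem_filter, not_and, not_lt]
          intro _
          rw [hr', h0]
      unfold pending
      omega
    have kG : ∀ i, ¬ s.arrived i → gap i ≤ τ₁ → s'.pending < s.pending := by
      intro i hi h0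
      have : (Finset.univ.filter fun i => ¬ s'.arrived i).card <
          (Finset.univ.filter fun i => ¬ s.arrived i).card := by
        refine Finset.card_lt_card ((Finset.ssubset_iff_of_subset sG).2 ⟨i, ?_, ?_⟩)
        · simpa using hi
        · simp only [Finset.mem_filter, Finset.mem_univ, true_and, not_not]
          exact Or.inr h0
      unfold pending
      omega
    rcases hp with hp | ⟨x, rfl⟩ | ⟨y, rfl⟩ | ⟨i, rfl⟩
    -- If nothing completes or arrives at the time of the merger, the state turns from incoherent to
    -- coherent and `rank` drops by this alone.
    · by_cases hlt' : s'.pending < s.pending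
      · exact key hlt'
      have e : s' = s.advance um ur τ₁ := by
        have : s'.arrived = s.arrived := by
          funext i
          refine propext ⟨fun h => ?_, Or.inl⟩
          by_contra hi
          exact hlt' (kG i hi (h.resolve_left hi))
        have e2 : s' = ⟨s'.arrived, (s.advance um ur τ₁).mapRem, (s.advance um ur τ₁).redRem⟩ := rfl
        rw [e2, this]
        rfl
      obtain ⟨q1, q2⟩ := hmerge τ₁ hτ₁.le (fun x hx => by
        refine lt_of_le_of_ne (hnn _ (mM x hx)) fun h => ?_
        exact hlt' (kM x hx h.symm)) (fun p h => hnn p (mE p h)) ⟨p, hp, hp0⟩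
      rw [← e] at q1
      have : s'.pending ≤ s.pending := by
        unfold pending
        omega
      simp only [rank, if_pos q1, if_neg q2]
      omega
    · exact key (kM x x.2 hp0)
    · exact key (kR y y.2 hp0)
    · exact key (kG i i.2 (by simp only [one_mul] at hp0; linarith))

/-- From every state the algorithm can run until the next event. -/
theorem exists_hasStep (hm0 : ∀ x, 0 ≤ s.mapRem x) (hr0 : ∀ y, 0 ≤ s.redRem y) {gap : Fin J → ℝ}
    (hgap : ∀ i, ¬ s.arrived i → 0 < gap i) :
    ∃ um ur, s.Rule α r um ur ∧ s.HasStep α r gap um ur := by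
  obtain ⟨R, hR⟩ := exists_selects s.IsShortestFreeRed
  by_cases hc : s.Coherent
  · rcases hc with ⟨x, hx1, hx2⟩ | hnone
    · have h1 : Selects s.IsShortestMap (some x) := by simpa [Selects] using hx1
      have h2 : Selects s.IsShortestMapOfSmallestJob (some x) := by simpa [Selects] using hx2
      -- With `M₁ = M₂` no merger clock is needed: only this map task shrinks, which keeps it
      -- shortest and its job smallest.
      refine ⟨_, _, rule_self h1 h2 hR, hasStep_of_selects hm0 hr0 hgap h1 h2 hR
        (E := ∅) Set.finite_empty (by simp) (fun τ hτ _ => ?_) (by simp)⟩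
      set um := s.mapSpeeds α r (some x) (some x) with hum
      have hz : ∀ x', x' ≠ x → um x' = 0 := fun x' h =>
        mapSpeeds_of_ne (fun e => h (Option.some.inj e).symm) (fun e => h (Option.some.inj e).symm)
      have hnn : ∀ x', 0 ≤ um x' * τ := fun x' => mul_nonneg (mapSpeeds_nonneg _ _ _) hτ
      have hle : ∀ x', s.mapRem x ≤ s.mapRem x' →
          s.mapRem x - um x * τ ≤ s.mapRem x' - um x' * τ := by
        intro x' h
        by_cases e : x' = x
        · rw [e]
        · rw [hz x' e]
          have := hnn x
          linarith
      constructor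
      · rintro z hz' x' hx'
        obtain rfl := Option.some.inj hz'
        exact hle x' (hx1.2 x' hx')
      · rintro z hz'
        obtain rfl := Option.some.inj hz'
        refine ⟨fun i hi => ?_, fun k hk => hle _ (hx2.2.2 k hk)⟩
        by_cases e : i = x.1
        · rw [e]
        · have h3 : ∑ k, (s.mapRem ⟨i, k⟩ - um ⟨i, k⟩ * τ) = s.cumMap i := by
            refine Finset.sum_congr rfl fun k _ => ?_
            rw [hz ⟨i, k⟩ (fun h => e (congrArg Sigma.fst h))]
            ring
          have h4 : ∑ k, (s.mapRem ⟨x.1, k⟩ - um ⟨x.1, k⟩ * τ) ≤ s.cumMap x.1 :=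
            Finset.sum_le_sum fun k _ => by
              have := hnn ⟨x.1, k⟩
              linarith
          rw [h3]
          exact h4.trans (hx2.2.1 i hi)
    · have h1 : Selects s.IsShortestMap none := ⟨by simp, fun _ x hx => hnone x hx.1⟩
      have h2 : Selects s.IsShortestMapOfSmallestJob none := ⟨by simp, fun _ x hx => hnone x hx.1⟩
      exact ⟨_, _, rule_self h1 h2 hR, hasStep_of_selects hm0 hr0 hgap h1 h2 hR
        (E := ∅) Set.finite_empty (by simp) (fun τ hτ _ => by simp [Persists]) (by simp)⟩
  · have hc' := hc
    simp only [Coherent, not_or, not_exists, not_forall, not_not, not_and] at hc'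
    obtain ⟨hno, x, hx⟩ := hc'
    obtain ⟨x₁, hx₁⟩ := exists_isShortestMap hx
    obtain ⟨x₂, hx₂⟩ := exists_isShortestMapOfSmallestJob hx
    -- Incoherence forces the selected tasks into different jobs, with both comparisons strict; an
    -- equality would make one task satisfy both rules.
    have hlt : s.mapRem x₁ < s.mapRem x₂ := by
      by_contra! h
      exact hno x₂ ⟨hx₂.1, fun x' hx' => h.trans (hx₁.2 x' hx')⟩ hx₂
    have hjob : x₁.1 ≠ x₂.1 := by
      intro e
      exact hno x₁ hx₁ ⟨hx₁.1, by rw [e]; exact hx₂.2.1, fun k hk => hx₁.2 _ hk⟩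
    have hcum : s.cumMap x₂.1 < s.cumMap x₁.1 := by
      by_contra! h
      exact hno x₁ hx₁ ⟨hx₁.1, fun i hi => h.trans (hx₂.2.1 i hi), fun k hk => hx₁.2 _ hk⟩
    have h1 : Selects s.IsShortestMap (some x₁) := by simpa [Selects] using hx₁
    have h2 : Selects s.IsShortestMapOfSmallestJob (some x₂) := by simpa [Selects] using hx₂
    set um := s.mapSpeeds α r (some x₁) (some x₂) with hum
    have hz : ∀ x', x' ≠ x₁ → x' ≠ x₂ → um x' = 0 := fun x' h h' =>
      mapSpeeds_of_ne (fun e => h (Option.some.inj e).symm) (fun e => h' (Option.some.inj e).symm)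
    have hsum : ∀ (x : (i : Fin J) × Fin (nm i)), (∀ x', x'.1 = x.1 → x' ≠ x → um x' = 0) → ∀ τ,
        ∑ k, (s.mapRem ⟨x.1, k⟩ - um ⟨x.1, k⟩ * τ) = s.cumMap x.1 - um x * τ := by
      rintro ⟨j, l⟩ h τ
      rw [Finset.sum_sub_distrib, ← Finset.sum_mul]
      congr 2
      refine Finset.sum_eq_single l (fun k _ hk => h ⟨j, k⟩ rfl fun e => hk ?_) (by simp)
      exact eq_of_heq (Sigma.mk.inj e).2
    have hs₁ := hsum x₁ fun x' e h => hz x' h fun h' => hjob (by rw [← e, h'])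
    have hs₂ := hsum x₂ fun x' e h => hz x' (fun h' => hjob (by rw [← e, h'])) h
    -- The two clocks are the lead of `x₁` in remaining size and the lead of the job of `x₂` in
    -- cumulative size. Every other map task, and every other job, is untouched and cannot overtake.
    have hper : ∀ τ, 0 ≤ τ → (∀ p ∈ ({(s.mapRem x₂ - s.mapRem x₁, um x₂ - um x₁),
        (s.cumMap x₁.1 - s.cumMap x₂.1, um x₁ - um x₂)} : Set (ℝ × ℝ)), 0 ≤ p.1 - p.2 * τ) →
        s.Persists um (some x₁) (some x₂) τ := by
      intro τ hτ hp
      have p1 := hp _ (Or.inl rfl)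
      have p2 := hp _ (Or.inr rfl)
      simp only at p1 p2
      have hnn : ∀ x', 0 ≤ um x' * τ := fun x' => mul_nonneg (mapSpeeds_nonneg _ _ _) hτ
      constructor
      · rintro z hz' x' hx'
        obtain rfl := Option.some.inj hz'
        by_cases e1 : x' = x₁
        · rw [e1]
        by_cases e2 : x' = x₂
        · rw [e2]
          linarith
        rw [hz x' e1 e2]
        have := hx₁.2 x' hx'
        have := hnn x₁
        linarith
      · rintro z hz'
        obtain rfl := Option.some.inj hz'
        refine ⟨fun i hi => ?_, fun k hk => ?_⟩
        · rw [hs₂]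
          by_cases e1 : i = x₁.1
          · rw [e1, hs₁]
            linarith
          by_cases e2 : i = x₂.1
          · rw [e2, hs₂]
          have h3 : ∑ k, (s.mapRem ⟨i, k⟩ - um ⟨i, k⟩ * τ) = s.cumMap i := by
            refine Finset.sum_congr rfl fun k _ => ?_
            rw [hz ⟨i, k⟩ (fun h => e1 (congrArg Sigma.fst h)) fun h => e2 (congrArg Sigma.fst h)]
            ring
          rw [h3]
          have := hx₂.2.1 i hi
          have := hnn x₂
          linarith
        · by_cases e : (⟨x₂.1, k⟩ : (i : Fin J) × Fin (nm i)) = x₂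
          · rw [e]
          rw [hz ⟨x₂.1, k⟩ (fun h => hjob (congrArg Sigma.fst h).symm) e]
          have := hx₂.2.2 k hk
          have := hnn x₂
          linarith
    refine ⟨_, _, rule_self h1 h2 hR, hasStep_of_selects hm0 hr0 hgap h1 h2 hR
      (E := {(s.mapRem x₂ - s.mapRem x₁, um x₂ - um x₁),
        (s.cumMap x₁.1 - s.cumMap x₂.1, um x₁ - um x₂)}) (Set.toFinite _) ?_ hper
      fun τ hτ hpos hnn hex => ⟨Or.inl ?_, hc⟩⟩
    · rintro p (rfl | rfl)
      · exact sub_pos.2 hlt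
      · exact sub_pos.2 hcum
    · have e1 := mapOut_advance (um := um) (ur := s.redSpeeds α R) (fun x => mapSpeeds_nonneg _ _ x) hτ hpos
      have e2 := jobMapping_advance e1
      obtain ⟨g1, g2⟩ := hper τ hτ hnn
      have g1 := g1 x₁ rfl
      have g2 := g2 x₂ rfl
      set s' := s.advance um (s.redSpeeds α R) τ with hs'
      have k1 : s'.IsShortestMap x₁ := ⟨by rw [e1]; exact hx₁.1, by rw [e1]; exact g1⟩
      have k2 : s'.IsShortestMapOfSmallestJob x₂ :=
        ⟨by rw [e1]; exact hx₂.1, by rw [e1, e2]; exact g2⟩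
      -- When the sizes meet, `x₂` also becomes a shortest task; when the cumulative sizes meet, the
      -- job of `x₁` also becomes a smallest job.
      obtain ⟨p, (rfl | rfl), hp0⟩ := hex
      · refine ⟨x₂, ⟨k2.1, fun x' hx' => ?_⟩, k2⟩
        have e : s'.mapRem x₂ = s'.mapRem x₁ := by
          change s.mapRem x₂ - um x₂ * τ = s.mapRem x₁ - um x₁ * τ
          simp only at hp0
          linarith
        rw [e]
        exact k1.2 x' hx'
      · refine ⟨x₁, k1, k1.1, fun i hi => ?_, fun k hk => k1.2 _ hk⟩
        have e : s'.cumMap x₁.1 = s'.cumMap x₂.1 := by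
          have q1 : s'.cumMap x₁.1 = s.cumMap x₁.1 - um x₁ * τ := hs₁ τ
          have q2 : s'.cumMap x₂.1 = s.cumMap x₂.1 - um x₂ * τ := hs₂ τ
          rw [q1, q2]
          simp only at hp0
          linarith
        rw [e]
        exact k2.2.1 i hi

end State

/-! ### Gluing the phases into a run -/

section Existence

lemma intervalIntegral_indicator_Ico (c : ℝ) {t₀ t₁ t : ℝ} (h : t₀ ≤ t) (h1 : t₀ ≤ t₁) :
    ∫ τ in t₀..t, (Set.Ico t₀ t₁).indicator (fun _ => c) τ = c * (min t t₁ - t₀) := by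
  rw [intervalIntegral.integral_of_le h, setIntegral_congr_set Ioc_ae_eq_Icc,
    setIntegral_indicator measurableSet_Ico,
    setIntegral_congr_set (t := Set.Icc t₀ (min t t₁))]
  · simp [h, h1, mul_comm]
  · rw [show Set.Icc t₀ (min t t₁) = Set.Icc t₀ t ∩ Set.Icc t₀ t₁ by
      rw [Set.Icc_inter_Icc, max_self]]
    exact (Filter.EventuallyEq.refl _ _).inter Ico_ae_eq_Icc

lemma intervalIntegrable_indicator_Ico (c t₀ t₁ a b : ℝ) :
    IntervalIntegrable ((Set.Ico t₀ t₁).indicator fun _ => c) volume a b := by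
  rw [intervalIntegrable_iff]
  exact (integrableOn_const (by simp)).indicator measurableSet_Ico

/-- A phase of constant rate on `[t₀, t₁)` followed by `v` amounts to restarting the task at `max b
t₁` with its reduced size. A task processed in the phase must have arrived exactly at `t₀`. -/
lemma remSize_add_indicator {s b c t₀ t₁ : ℝ} {v : ℝ → ℝ} (h1 : t₀ ≤ t₁)
    (hv : ∀ a b, IntervalIntegrable v volume a b) (hv0 : ∀ t, t < max b t₁ → v t = 0)
    (hc : c ≠ 0 → b = t₀) {t : ℝ} (ht : t₀ ≤ t) :
    remSize s b ((Set.Ico t₀ t₁).indicator (fun _ => c) + v) t =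
      remSize (s - c * (min t t₁ - t₀)) (max b t₁) v t := by
  have e1 : ∫ τ in b..t, ((Set.Ico t₀ t₁).indicator (fun _ => c) + v) τ =
      (∫ τ in b..t, (Set.Ico t₀ t₁).indicator (fun _ => c) τ) + ∫ τ in b..t, v τ :=
    intervalIntegral.integral_add (intervalIntegrable_indicator_Ico _ _ _ _ _) (hv _ _)
  have e2 : ∫ τ in b..t, (Set.Ico t₀ t₁).indicator (fun _ => c) τ = c * (min t t₁ - t₀) := by
    by_cases h : c = 0
    · simp [h]
    · rw [hc h]
      exact intervalIntegral_indicator_Ico c ht h1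
  have e3 : ∫ τ in b..t, v τ = ∫ τ in (max b t₁)..t, v τ := by
    have h2 := remSize_of_le (s := 0) hv0 (le_max_left b t₁)
    have h3 := intervalIntegral.integral_add_adjacent_intervals (hv (max b t₁) b) (hv b t)
    simp only [remSize] at h2
    linarith
  unfold remSize
  rw [e1, e2, e3]
  ring

variable {J : ℕ} {nm nr : Fin J → ℕ}

/-- The state at time `t` when the tasks are processed at the rates `um`, `ur`. -/
noncomputable def stateAt (arr : Fin J → ℝ) (ms : ((i : Fin J) × Fin (nm i)) → ℝ)
    (rs : ((i : Fin J) × Fin (nr i)) → ℝ) (um : ((i : Fin J) × Fin (nm i)) → ℝ → ℝ)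
    (ur : ((i : Fin J) × Fin (nr i)) → ℝ → ℝ) (t : ℝ) : State nm nr where
  arrived i := arr i ≤ t
  mapRem x := remSize (ms x) (arr x.1) (um x) t
  redRem y := remSize (rs y) (arr y.1) (ur y) t

/-- Strong induction on the rank. After each phase the input is restarted at the event time `t₁`,
with past arrivals moved up to `t₁` and sizes replaced by remaining sizes. Hence jobs already
present always have arrival time equal to the start time. -/
theorem exists_rates (α : ℝ) (r : ℕ) (N : ℕ) : ∀ (arr : Fin J → ℝ)
    (ms : ((i : Fin J) × Fin (nm i)) → ℝ) (rs : ((i : Fin J) × Fin (nr i)) → ℝ)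
    (_ : ∀ x, 0 ≤ ms x) (_ : ∀ y, 0 ≤ rs y) (t₀ : ℝ) (_ : ∀ i, t₀ ≤ arr i)
    (_ : (State.mk (fun i => arr i ≤ t₀) ms rs).rank ≤ N),
    ∃ um ur, (∀ x a b, IntervalIntegrable (um x) volume a b) ∧
      (∀ y a b, IntervalIntegrable (ur y) volume a b) ∧
      ∀ t, (stateAt arr ms rs um ur t).Rule α r (fun x => um x t) (fun y => ur y t) := by
  induction N using Nat.strong_induction_on with
  | _ N ih =>
  intro arr ms rs hms hrs t₀ ht₀ hN
  set s : State nm nr := ⟨fun i => arr i ≤ t₀, ms, rs⟩ with hs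
  obtain ⟨cm, cr, hrule, hstep⟩ := State.exists_hasStep (s := s) (α := α) (r := r) hms hrs
    (gap := fun i => arr i - t₀) (fun i hi => by
      have : ¬ arr i ≤ t₀ := hi
      linarith)
  have hcm : ∀ x, cm x ≠ 0 → arr x.1 = t₀ := fun x hx =>
    le_antisymm (hrule.mapOut hx).1 (ht₀ _)
  have hcr : ∀ y, cr y ≠ 0 → arr y.1 = t₀ := fun y hy =>
    le_antisymm (hrule.redFree hy).1 (ht₀ _)
  rcases hstep with ⟨hforever, harr⟩ | ⟨τ₁, hτ₁, hbefore, hm1, hr1, hgap, hrank⟩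
  · have harr' : ∀ i, arr i = t₀ := fun i => le_antisymm (harr i) (ht₀ i)
    have hint : ∀ c a b : ℝ,
        IntervalIntegrable ((Set.Ici t₀).indicator fun _ => c) volume a b := fun c a b => by
      rw [intervalIntegrable_iff]
      exact (integrableOn_const (by simp)).indicator measurableSet_Ici
    refine ⟨fun x => (Set.Ici t₀).indicator fun _ => cm x,
      fun y => (Set.Ici t₀).indicator fun _ => cr y, fun x => hint _, fun y => hint _, fun t => ?_⟩
    rcases lt_or_ge t t₀ with ht | ht
    · simp only [Set.indicator_of_notMem (Set.notMem_Ici.2 ht)]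
      exact State.rule_of_not_arrived fun i hi => not_le.2 (ht.trans_le (ht₀ i)) hi
    · simp only [Set.indicator_of_mem (Set.mem_Ici.2 ht)]
      have key : ∀ c σ : ℝ, remSize σ t₀ ((Set.Ici t₀).indicator fun _ => c) t =
          σ - c * (t - t₀) := by
        intro c σ
        have : ∫ τ in t₀..t, (Set.Ici t₀).indicator (fun _ => c) τ = ∫ τ in t₀..t, c := by
          refine intervalIntegral.integral_congr fun τ hτ => ?_
          rw [Set.uIcc_of_le ht] at hτ
          exact Set.indicator_of_mem (Set.mem_Ici.2 hτ.1) _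
        rw [remSize, this, intervalIntegral.integral_const, smul_eq_mul, mul_comm]
      have e : stateAt arr ms rs (fun x => (Set.Ici t₀).indicator fun _ => cm x)
          (fun y => (Set.Ici t₀).indicator fun _ => cr y) t = s.advance cm cr (t - t₀) := by
        simp only [stateAt, State.advance, hs, harr', key, ht, le_refl]
      rw [e]
      exact hforever _ (sub_nonneg.2 ht)
  · set t₁ := t₀ + τ₁ with ht₁
    have h01 : t₀ ≤ t₁ := by linarith
    have hlate : ∀ i, ¬ arr i ≤ t₀ → t₁ ≤ arr i := fun i hi => by
      have := hgap i hi
      linarith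
    have hst : (State.mk (fun i => max (arr i) t₁ ≤ t₁) (fun x => ms x - cm x * τ₁)
        (fun y => rs y - cr y * τ₁) : State nm nr) =
        (s.advance cm cr τ₁).arrive (fun i => arr i - t₀) τ₁ := by
      simp only [State.arrive, State.advance, hs, State.mk.injEq, and_true]
      funext i
      refine propext ⟨fun h => Or.inr ?_, fun h => max_le ?_ le_rfl⟩
      · have := (le_max_left _ _).trans h
        linarith
      · rcases h with h | h <;> linarith
    obtain ⟨vm, vr, hvm, hvr, hv⟩ := ih _ (hrank.trans_le hN) (fun i => max (arr i) t₁)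
      (fun x => ms x - cm x * τ₁) (fun y => rs y - cr y * τ₁) hm1 hr1 t₁
      (fun i => le_max_right _ _) (by rw [hst])
    have hvm0 : ∀ x t, t < max (arr x.1) t₁ → vm x t = 0 := fun x t ht => by
      by_contra h
      exact not_le.2 ht ((hv t).mapOut h).1
    have hvr0 : ∀ y t, t < max (arr y.1) t₁ → vr y t = 0 := fun y t ht => by
      by_contra h
      exact not_le.2 ht ((hv t).redFree h).1
    refine ⟨fun x => (Set.Ico t₀ t₁).indicator (fun _ => cm x) + vm x,
      fun y => (Set.Ico t₀ t₁).indicator (fun _ => cr y) + vr y,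
      fun x a b => (intervalIntegrable_indicator_Ico _ _ _ _ _).add (hvm x a b),
      fun y a b => (intervalIntegrable_indicator_Ico _ _ _ _ _).add (hvr y a b), fun t => ?_⟩
    simp only [Pi.add_apply]
    rcases lt_or_ge t t₀ with ht | ht
    · have hn : t ∉ Set.Ico t₀ t₁ := fun h => not_le.2 ht h.1
      simp only [Set.indicator_of_notMem hn, hvm0 _ t (lt_max_of_lt_right (ht.trans_le h01)),
        hvr0 _ t (lt_max_of_lt_right (ht.trans_le h01)), add_zero]
      exact State.rule_of_not_arrived fun i hi => not_le.2 (ht.trans_le (ht₀ i)) hi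
    · have em : ∀ x, remSize (ms x) (arr x.1) ((Set.Ico t₀ t₁).indicator (fun _ => cm x) + vm x) t =
          remSize (ms x - cm x * (min t t₁ - t₀)) (max (arr x.1) t₁) (vm x) t := fun x =>
        remSize_add_indicator h01 (hvm x) (hvm0 x) (hcm x) ht
      have er : ∀ y, remSize (rs y) (arr y.1) ((Set.Ico t₀ t₁).indicator (fun _ => cr y) + vr y) t =
          remSize (rs y - cr y * (min t t₁ - t₀)) (max (arr y.1) t₁) (vr y) t := fun y =>
        remSize_add_indicator h01 (hvr y) (hvr0 y) (hcr y) ht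
      rcases lt_or_ge t t₁ with ht1 | ht1
      · have hmem : t ∈ Set.Ico t₀ t₁ := ⟨ht, ht1⟩
        simp only [Set.indicator_of_mem hmem, hvm0 _ t (lt_max_of_lt_right ht1),
          hvr0 _ t (lt_max_of_lt_right ht1), add_zero]
        have e : stateAt arr ms rs (fun x => (Set.Ico t₀ t₁).indicator (fun _ => cm x) + vm x)
            (fun y => (Set.Ico t₀ t₁).indicator (fun _ => cr y) + vr y) t =
            s.advance cm cr (t - t₀) := by
          simp only [stateAt, State.advance, hs, State.mk.injEq]
          refine ⟨?_, ?_, ?_⟩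
          · funext i
            refine propext ⟨fun h => ?_, fun h => h.trans ht⟩
            by_contra hi
            have := hlate i hi
            linarith
          · funext x
            rw [em, remSize_of_le (hvm0 x) (lt_max_of_lt_right ht1).le, min_eq_left ht1.le]
          · funext y
            rw [er, remSize_of_le (hvr0 y) (lt_max_of_lt_right ht1).le, min_eq_left ht1.le]
        rw [e]
        exact hbefore _ (sub_nonneg.2 ht) (by linarith)
      -- The phase is half-open, so at the event time `t₁` the rule is already that of the restarted
      -- input.
      · have hn : t ∉ Set.Ico t₀ t₁ := fun h => not_le.2 h.2 ht1
        simp only [Set.indicator_of_notMem hn, zero_add]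
        have e : stateAt arr ms rs (fun x => (Set.Ico t₀ t₁).indicator (fun _ => cm x) + vm x)
            (fun y => (Set.Ico t₀ t₁).indicator (fun _ => cr y) + vr y) t =
            stateAt (fun i => max (arr i) t₁) (fun x => ms x - cm x * τ₁)
              (fun y => rs y - cr y * τ₁) vm vr t := by
          have h3 : t₁ - t₀ = τ₁ := by linarith
          simp only [stateAt, State.mk.injEq]
          refine ⟨?_, ?_, ?_⟩
          · funext i
            simp [ht1]
          · funext x
            rw [em, min_eq_right ht1, h3]
          · funext y
            rw [er, min_eq_right ht1, h3]
        rw [e]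
        exact hv t

theorem exists_isRun (α : ℝ) (r : ℕ) (I : Input) : ∃ S : Rates I, IsRun α r S := by
  obtain ⟨T₁, hT₁⟩ : ∃ T₁, ∀ i, T₁ ≤ I.arrival i := by
    obtain ⟨B, hB⟩ := (Set.finite_range I.arrival).bddBelow
    exact ⟨B, fun i => hB (Set.mem_range_self i)⟩
  obtain ⟨um, ur, hum, hur, h⟩ := exists_rates (nm := I.numMap) (nr := I.numRed) α r _ I.arrival
    (fun x => I.mapSize x.1 x.2) (fun y => I.redSize y.1 y.2)
    (fun x => I.mapSize_nonneg _ _) (fun y => I.redSize_nonneg _ _) T₁ hT₁ le_rfl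
  refine ⟨⟨um, ur⟩, ⟨fun x t => (h t).map_nonneg x, fun y t => (h t).red_nonneg y, hum, hur,
    fun x t hx => (h t).mapOut hx, fun y t hy => (h t).redFree hy⟩, fun t => h t⟩

end Existence

end MapReduce

theorem theorem3 (α : ℝ) (hα1 : 1 < α) (hα2 : α < 2) (I : MapReduce.Input) (r : ℕ)
    (hr : ∀ i, I.numRed i = r) :
    (∃ S : MapReduce.Rates I, MapReduce.IsRun α r S) ∧
    ∀ S : MapReduce.Rates I, MapReduce.IsRun α r S →
      S.cost α ≤ ENNReal.ofReal (8 + 4 / (2 - α) + 3 ^ α) * I.optCost α :=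
  ⟨MapReduce.exists_isRun α r I, fun _ h => h.cost_le_optCost hα1 hα2 hr⟩
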